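/- Let $n\ge 1$ and consider the single-input single-output system $\dot x=f(x)+g(x)u$, $y=h(x)$ (no measurement noise) with $f,g:\mathbb R^n\to\mathbb R^n$ and $h:\mathbb R^n\to\mathbb R$ smooth. Assume that $h$ has relative degree $n$ on $\mathbb R^n$, i.e. $L_gL_f^ih\equiv 0$ for $0\le i\le n-2$ and $L_gL_f^{n-1}h(x)\neq 0$ for all $x$, and that the (known) sign of the control gain $L_gL_f^{n-1}h$ is positive. Assume also that $\Psi=(h,L_fh,\dots,L_f^{n-1}h)$ is a smooth diffeomorphism of $\mathbb R^n$ onto $\mathbb R^n$ with $\Psi(0)=0$. Write $z=\Psi(x)\in\mathbb R^n$, $\alpha=L_f^nh$ and $\beta=L_gL_f^{n-1}h$ (evaluated along $x$), $z_{n+1}=\alpha+\beta u$ and $u_0=-\alpha(0)/\beta(0)$; norms are Euclidean. Let $A_1,B_1$ be the matrices of a chain of $n$ integrators, let $K$ be a row vector such that $(A_1+B_1K)^TP+P(A_1+B_1K)=-Q$ for some symmetric positive definite $P,Q$, and let $v(z)=Kz$. Fix $\rho\ge 1$ and real numbers $u^*_0,\dots,u^*_{\rho-1}$. For a sampling time $T>0$,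 the input is held constant, equal to $u(k)$, on each interval $[kT,(k+1)T]$, $k\in\mathbb N$. It is given by $u(k)=u^*_k$ for $k\le\rho-1$ and by $$u(k+1)=u(k)+\gamma\bigl(v(\hat z_1(k),\dots,\hat z_n(k))-\hat z_{n+1}(k)\bigr)\qquad\text{for } k\ge\rho-1,$$ where the estimate $\hat z(k)\in\mathbb R^{n+1}$ of $(z(kT),z_{n+1}(k))$, with $z_{n+1}(k)=\alpha+\beta u(k)$ at $x(kT)$, is produced by a causal estimator, i.e. it is a function of $T$, $k$, the output $y$ on $[0,kT]$ and $u(0),\dots,u(k)$. The input error is $e_u(k)=v(z(kT))-z_{n+1}(k)$. Let $\mathcal S\subset\mathbb R^n$ be a compact set containing the origin in its interior. Then there is $\gamma^*>0$ (with $\gamma^*\ge 1/\bar\beta$ whenever $\beta\le\bar\beta$ on $\mathbb R^n$) such that the following holds for every $\gamma\in(0,\gamma^*)$ and every causal estimator whose error is $O(T)$ on this closed loop in the following sense: for every compact $D\subset\mathbb R^{n+1}$ there are $M,T_0>0$ such that, for all $T\in(0,T_0]$, along every closed-loop trajectory that starts in $\mathcal S$, exists up to time $kT$ with $k\ge\rho-1$,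 and has $(z(jT),u(j))\in D$ for all $j\le k$, $$\bigl\|(z(kT),z_{n+1}(k))-\hat z(k)\bigr\|\le M\,T\,\bigl\|(z(kT),u(k)-u_0)\bigr\|.$$ There are a time $T^*>0$ and a bound $b>0$ such that, for every $T\in(0,T^*]$ and every $x_0\in\mathcal S$, a closed-loop trajectory with $x(0)=x_0$ exists on $[0,\infty)$, and every such trajectory satisfies $\|\hat z(k)\|\le b$ for all $k\ge\rho-1$, $|e_u(k)|\le b$ for all $k\in\mathbb N$, $\|x(t)\|\le b$ for all $t\ge 0$, and $\lim_{t\to\infty}x(t)=0$. -/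

import Mathlib

open Set Filter Topology
open scoped ContDiff

/-- The Lie derivative `L_f h = (∂h/∂x) f` of a function `h` along a vector field `f`. -/
noncomputable def lieDeriv {n : ℕ} (f : EuclideanSpace ℝ (Fin n) → EuclideanSpace ℝ (Fin n))
    (h : EuclideanSpace ℝ (Fin n) → ℝ) : EuclideanSpace ℝ (Fin n) → ℝ :=
  fun x => fderiv ℝ h x (f x)

/-- The drift term `L_f^n h` (the function `α`, as a function of the state `x`). -/
noncomputable def driftTerm {n : ℕ} (f : EuclideanSpace ℝ (Fin n) → EuclideanSpace ℝ (Fin n))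
    (h : EuclideanSpace ℝ (Fin n) → ℝ) : EuclideanSpace ℝ (Fin n) → ℝ :=
  (lieDeriv f)^[n] h

/-- The control gain `L_g L_f^{n-1} h` (the function `β`, as a function of the state `x`). -/
noncomputable def controlGain {n : ℕ} (f g : EuclideanSpace ℝ (Fin n) → EuclideanSpace ℝ (Fin n))
    (h : EuclideanSpace ℝ (Fin n) → ℝ) : EuclideanSpace ℝ (Fin n) → ℝ :=
  lieDeriv g ((lieDeriv f)^[n - 1] h)

/-- The output `h` of `ẋ = f(x) + g(x)u` on `ℝⁿ` has relative degree `n` at every point. -/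
def HasFullRelativeDegree {n : ℕ} (f g : EuclideanSpace ℝ (Fin n) → EuclideanSpace ℝ (Fin n))
    (h : EuclideanSpace ℝ (Fin n) → ℝ) : Prop :=
  (∀ i : ℕ, i + 1 < n → ∀ x, lieDeriv g ((lieDeriv f)^[i] h) x = 0) ∧
    ∀ x, controlGain f g h x ≠ 0

/-- The linearizing coordinates `Ψ(x) = (h(x), L_f h(x), …, L_f^{n-1} h(x))`. -/
noncomputable def linCoord {n : ℕ} (f : EuclideanSpace ℝ (Fin n) → EuclideanSpace ℝ (Fin n))
    (h : EuclideanSpace ℝ (Fin n) → ℝ) (x : EuclideanSpace ℝ (Fin n)) :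
    EuclideanSpace ℝ (Fin n) :=
  WithLp.toLp 2 (fun i : Fin n => (lieDeriv f)^[(i : ℕ)] h x)

/-- `Ψ` is a smooth diffeomorphism of `ℝⁿ` onto itself. -/
def IsSmoothDiffeo {n : ℕ} (Ψ : EuclideanSpace ℝ (Fin n) → EuclideanSpace ℝ (Fin n)) : Prop :=
  ContDiff ℝ ∞ Ψ ∧ ∃ Φ : EuclideanSpace ℝ (Fin n) → EuclideanSpace ℝ (Fin n),
    ContDiff ℝ ∞ Φ ∧ Function.LeftInverse Φ Ψ ∧ Function.RightInverse Φ Ψ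

/-- The vector `(z, s) ∈ ℝⁿ⁺¹` with Euclidean norm. -/
noncomputable def appendCoord {n : ℕ} (z : EuclideanSpace ℝ (Fin n)) (s : ℝ) :
    EuclideanSpace ℝ (Fin (n + 1)) :=
  WithLp.toLp 2 (Fin.snoc (α := fun _ => ℝ) (fun i : Fin n => z i) s)

/-- The input `u₀ = -β(0)⁻¹ α(0)` that makes the origin an equilibrium. -/
noncomputable def equilibriumInput {n : ℕ}
    (f g : EuclideanSpace ℝ (Fin n) → EuclideanSpace ℝ (Fin n))
    (h : EuclideanSpace ℝ (Fin n) → ℝ) : ℝ :=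
  -(controlGain f g h 0)⁻¹ * driftTerm f h 0

/-- The matrix `A₁` of a chain of `n` integrators. -/
def chainMatrix (n : ℕ) : Matrix (Fin n) (Fin n) ℝ :=
  Matrix.of fun i j => if (i : ℕ) + 1 = (j : ℕ) then 1 else 0

/-- The input vector `B₁` of a chain of `n` integrators. -/
def chainInput (n : ℕ) : Fin n → ℝ := fun i => if (i : ℕ) + 1 = n then 1 else 0

/-- The row vector `K` solves the Lyapunov equation
`(A₁ + B₁K)ᵀ P + P (A₁ + B₁K) = -Q` for some symmetric positive definite `P`, `Q`. -/
def IsStabilizingGain {n : ℕ} (K : Fin n → ℝ) : Prop :=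
  ∃ P Q : Matrix (Fin n) (Fin n) ℝ, P.PosDef ∧ Q.PosDef ∧
    (chainMatrix n + Matrix.vecMulVec (chainInput n) K).transpose * P +
      P * (chainMatrix n + Matrix.vecMulVec (chainInput n) K) = -Q

/-- The linear virtual controller `v(z) = Kz`. -/
def virtualInput {n : ℕ} (K : Fin n → ℝ) (z : Fin n → ℝ) : ℝ := ∑ i, K i * z i

/-- A state estimation technique: for each sampling time `T`, each sampling index `k`, each
noise-free output signal `t ↦ y(t)` and each sequence `j ↦ u(j)` of inputs, the estimate
`ẑ(k) ∈ ℝⁿ⁺¹`. -/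
abbrev Estimator (n : ℕ) : Type :=
  ℝ → ℕ → (ℝ → ℝ) → (ℕ → ℝ) → EuclideanSpace ℝ (Fin (n + 1))

/-- At time `kT` the estimate uses the output on `[0, kT]` and the inputs `u(0), …, u(k)` only. -/
def Estimator.IsCausal {n : ℕ} (est : Estimator n) : Prop :=
  ∀ (T : ℝ) (k : ℕ) (y y' : ℝ → ℝ) (u u' : ℕ → ℝ), 0 < T →
    (∀ t ∈ Icc (0 : ℝ) (k * T), y t = y' t) → (∀ j ≤ k, u j = u' j) →
      est T k y u = est T k y' u'

/-- The state `x` on `[0, NT]` and the inputs `u(0), …, u(N)` form a trajectory of the closed loop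
with sampling time `T`: the input is held equal to `u(k)` on the `k`-th sampling interval; the first
`ρ` inputs are the prescribed `ustar 0, …, ustar (ρ - 1)`; as soon as estimates are available
(`k ≥ ρ - 1`), the input follows `u(k+1) = u(k) + γ (v(ẑ(k)) - ẑ_{n+1}(k))`. -/
structure IsClosedLoopUpTo {n : ℕ}
    (f g : EuclideanSpace ℝ (Fin n) → EuclideanSpace ℝ (Fin n))
    (h : EuclideanSpace ℝ (Fin n) → ℝ) (K : Fin n → ℝ) (γ : ℝ) (ρ : ℕ) (ustar : ℕ → ℝ)
    (est : Estimator n) (T : ℝ) (N : ℕ) (x : ℝ → EuclideanSpace ℝ (Fin n)) (u : ℕ → ℝ) :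
    Prop where
  dynamics : ∀ k < N, ∀ t ∈ Icc (k * T) ((k + 1) * T),
    HasDerivWithinAt x (f (x t) + u k • g (x t)) (Icc (k * T) ((k + 1) * T)) t
  transient : ∀ k < ρ, k ≤ N → u k = ustar k
  update : ∀ k < N, ρ ≤ k + 1 →
    u (k + 1) = u k + γ *
      (virtualInput K (fun i : Fin n => est T k (fun t => h (x t)) u i.castSucc) -
        est T k (fun t => h (x t)) u (Fin.last n))

/-- A closed-loop trajectory on `[0, ∞)`. -/
def IsClosedLoop {n : ℕ} (f g : EuclideanSpace ℝ (Fin n) → EuclideanSpace ℝ (Fin n))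
    (h : EuclideanSpace ℝ (Fin n) → ℝ) (K : Fin n → ℝ) (γ : ℝ) (ρ : ℕ) (ustar : ℕ → ℝ)
    (est : Estimator n) (T : ℝ) (x : ℝ → EuclideanSpace ℝ (Fin n)) (u : ℕ → ℝ) : Prop :=
  ∀ N : ℕ, IsClosedLoopUpTo f g h K γ ρ ustar est T N x u

/-- The value `z_{n+1} = α + β u` at the state `x` with input `u`. -/
noncomputable def topDeriv {n : ℕ} (f g : EuclideanSpace ℝ (Fin n) → EuclideanSpace ℝ (Fin n))
    (h : EuclideanSpace ℝ (Fin n) → ℝ) (x : EuclideanSpace ℝ (Fin n)) (u : ℝ) : ℝ :=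
  driftTerm f h x + controlGain f g h x * u

/-- The input error `e_u = v(z) - (α + β u)` at the state `x` with input `u`. -/
noncomputable def inputError {n : ℕ} (f g : EuclideanSpace ℝ (Fin n) → EuclideanSpace ℝ (Fin n))
    (h : EuclideanSpace ℝ (Fin n) → ℝ) (K : Fin n → ℝ) (x : EuclideanSpace ℝ (Fin n)) (u : ℝ) :
    ℝ :=
  virtualInput K (fun i => linCoord f h x i) - topDeriv f g h x u

/-- The estimation error satisfies `e_z = O_{(z, u - u₀)}(T)`: for every compact set `D` there are
constants `M, T₀ > 0` such that, for all sampling times `T ≤ T₀`, along every closed-loop trajectory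
that starts in `S` and whose sampled pairs `(z(j), u(j))` have stayed in `D` up to time `kT`, where
`k ≥ ρ - 1`, one has `‖e_z(k)‖ ≤ M T ‖(z(k), u(k) - u₀)‖`. -/
def HasErrorOrderT {n : ℕ} (f g : EuclideanSpace ℝ (Fin n) → EuclideanSpace ℝ (Fin n))
    (h : EuclideanSpace ℝ (Fin n) → ℝ) (K : Fin n → ℝ) (γ : ℝ) (ρ : ℕ) (ustar : ℕ → ℝ)
    (est : Estimator n) (S : Set (EuclideanSpace ℝ (Fin n))) : Prop :=
  ∀ D : Set (EuclideanSpace ℝ (Fin (n + 1))), IsCompact D →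
    ∃ M > 0, ∃ T₀ > 0, ∀ T : ℝ, 0 < T → T ≤ T₀ →
      ∀ (x : ℝ → EuclideanSpace ℝ (Fin n)) (u : ℕ → ℝ) (k : ℕ),
        IsClosedLoopUpTo f g h K γ ρ ustar est T k x u → x 0 ∈ S →
        (∀ j ≤ k, appendCoord (linCoord f h (x (j * T))) (u j) ∈ D) → ρ ≤ k + 1 →
          ‖appendCoord (linCoord f h (x (k * T))) (topDeriv f g h (x (k * T)) (u k)) -
              est T k (fun t => h (x t)) u‖ ≤
            M * T * ‖appendCoord (linCoord f h (x (k * T))) (u k - equilibriumInput f g h)‖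

/-! In the coordinates z = Ψ(x) the loop is ż = (A₁ + B₁K)z - e B₁, where e is the input error. Two
effects with separated time scales are coupled.

Slow: with V(z) = ⟪z, Pz⟫, one sampling interval gives V⁺ ≤ (1 - aT)V + CTe². Fast: since z_{n+1} is
affine in u with slope β, the update gives e⁺ = (1 - γβ⁺)e + O(T)(‖z‖ + |e|), where β⁺ is the gain
at the next sample. If γβ < 1 on the relevant ball, this contracts at a rate independent of T, so
(e⁺)² ≤ q e² + C₂T²V with q < 1. The weighted sum V + lTe² then decreases by a factor 1 - κT.

These estimates are proportional to ‖z‖ + |e|, not merely bounded, because the vector field vanishes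
at (0, u₀) and u is a smooth function of (z, e); this gives convergence to the origin exactly. The
constants are local, so the bounds V ≤ c + 1 and e² ≤ e₀ are fixed before T and recovered by
induction for small T. During the prescribed inputs e is only bounded, but V can grow only by O(T).
The same bounds on every finite trajectory let it be extended by one more interval.

The estimates are carried by `exists_sampled_step_estimates` (one interval) and
`exists_sampled_invariant` (the coupled recursion). -/

/-- A `C¹` map is Lipschitz on bounded balls. -/
theorem exists_lipschitz_bound_closedBall {E F : Type*} [NormedAddCommGroup E] [NormedSpace ℝ E]
    [FiniteDimensional ℝ E] [NormedAddCommGroup F] [NormedSpace ℝ F]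
    {φ : E → F} (hφ : ContDiff ℝ 1 φ) (R : ℝ) :
    ∃ L > 0, ∀ x y, ‖x‖ ≤ R → ‖y‖ ≤ R → ‖φ x - φ y‖ ≤ L * ‖x - y‖ := by
  have := FiniteDimensional.proper_real E
  obtain ⟨L, hL⟩ := (hφ.locallyLipschitz.locallyLipschitzOn
    (s := Metric.closedBall (0 : E) R)).exists_lipschitzOnWith_of_compact
      (isCompact_closedBall _ _)
  refine ⟨L + 1, by positivity, fun x y hx hy => ?_⟩
  refine (hL.norm_sub_le (by simpa using hx) (by simpa using hy)).trans ?_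
  gcongr
  linarith

/-- A continuous real function is bounded in absolute value on balls. -/
theorem exists_norm_bound_closedBall {E F : Type*} [NormedAddCommGroup E] [NormedSpace ℝ E]
    [FiniteDimensional ℝ E] [NormedAddCommGroup F]
    {φ : E → F} (hφ : Continuous φ) (R : ℝ) :
    ∃ L > 0, ∀ x, ‖x‖ ≤ R → ‖φ x‖ ≤ L := by
  have := FiniteDimensional.proper_real E
  obtain ⟨L, hL⟩ := (isCompact_closedBall (0 : E) R).exists_bound_of_continuousOn hφ.continuousOn
  refine ⟨|L| + 1, by positivity, fun x hx => (hL x (by simpa using hx)).trans ?_⟩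
  linarith [le_abs_self L]

/-! ### Differential equations over one short interval -/

section ODE

variable {E : Type*} [NormedAddCommGroup E] [NormedSpace ℝ E]

/-- A solution of `ż = φ(z)` stays close to its initial point, at a rate given by the size
`L * m` of the vector field there. -/
theorem norm_sub_initial_le_of_hasDerivWithinAt {φ : E → E} {z : ℝ → E} {t₀ t₁ L m r : ℝ}
    (hz : ∀ t ∈ Icc t₀ t₁, HasDerivWithinAt z (φ (z t)) (Icc t₀ t₁) t)
    (hL : 0 < L) (hT : 2 * L * (t₁ - t₀) ≤ 1)
    (hlip : ∀ w, ‖w - z t₀‖ ≤ r → ‖φ w - φ (z t₀)‖ ≤ L * ‖w - z t₀‖)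
    (h0 : ‖φ (z t₀)‖ ≤ L * m) (hr : 2 * L * m * (t₁ - t₀) < r) :
    ∀ t ∈ Icc t₀ t₁, ‖z t - z t₀‖ ≤ 2 * L * m * (t - t₀) := by
  intro t ht
  have h01 : t₀ ≤ t₁ := ht.1.trans ht.2
  -- The barrier argument needs a strict slope inequality at contact, hence m' > m, with m' → m at
  -- the end. At contact the speed is at most Lm + Lm' < 2Lm', because 2L(s - t₀) ≤ 1.
  have key : ∀ m', m < m' → 2 * L * m' * (t₁ - t₀) ≤ r →
      ‖z t - z t₀‖ ≤ 2 * L * m' * (t - t₀) := by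
    intro m' hm hr'
    have hm0 : 0 ≤ m := nonneg_of_mul_nonneg_right ((norm_nonneg _).trans h0) hL
    have hcont : ContinuousOn z (Icc t₀ t₁) := fun s hs => (hz s hs).continuousWithinAt
    refine image_norm_le_of_norm_deriv_right_lt_deriv_boundary'
      (f := fun s => z s - z t₀) (f' := fun s => φ (z s))
      (B := fun s => 2 * L * m' * (s - t₀)) (B' := fun _ => 2 * L * m')
      (by fun_prop) ?_ (by simp) (by fun_prop) ?_ ?_ ht
    · intro s hs
      exact ((hz s (Ico_subset_Icc_self hs)).mono_of_mem_nhdsWithin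
        (Icc_mem_nhdsGE_of_mem hs)).sub_const _
    · intro s _
      simpa using (((hasDerivAt_id s).sub_const t₀).const_mul (2 * L * m')).hasDerivWithinAt
    · intro s hs hB
      have hst : s - t₀ ≤ t₁ - t₀ := by linarith [hs.2]
      have h1 : ‖z s - z t₀‖ ≤ r := by
        rw [hB]
        refine le_trans ?_ hr'
        have : 0 ≤ m' := by linarith
        gcongr
      have h2 := hlip _ h1
      rw [hB] at h2
      have h3 : ‖φ (z s)‖ ≤ L * m + L * (2 * L * m' * (s - t₀)) := by
        calc ‖φ (z s)‖ = ‖φ (z t₀) + (φ (z s) - φ (z t₀))‖ := by congr 1; abel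
          _ ≤ _ := (norm_add_le _ _).trans (add_le_add h0 h2)
      have h4 : L * (2 * L * m' * (s - t₀)) ≤ L * m' := by
        have : 2 * L * (s - t₀) ≤ 1 := by
          refine le_trans ?_ hT
          gcongr
        have : m' * (2 * L * (s - t₀)) ≤ m' * 1 :=
          mul_le_mul_of_nonneg_left this (by linarith)
        nlinarith
      nlinarith
  have hlim : Tendsto (fun m' => 2 * L * m' * (t - t₀)) (𝓝[>] m) (𝓝 (2 * L * m * (t - t₀))) := by
    refine Tendsto.mono_left (Continuous.tendsto ?_ m) nhdsWithin_le_nhds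
    fun_prop
  refine ge_of_tendsto hlim ?_
  have hev : ∀ᶠ m' in 𝓝[>] m, 2 * L * m' * (t₁ - t₀) < r := by
    refine nhdsWithin_le_nhds ((Continuous.tendsto
      (f := fun m' => 2 * L * m' * (t₁ - t₀)) (by fun_prop) m).eventually_lt_const hr)
  filter_upwards [hev, self_mem_nhdsWithin] with m' h1 h2
  exact key m' h2 h1.le

/-- The error of one explicit Euler step. -/
theorem norm_sub_euler_step_le {φ : E → E} {z : ℝ → E} {t₀ t₁ L m r : ℝ}
    (hz : ∀ t ∈ Icc t₀ t₁, HasDerivWithinAt z (φ (z t)) (Icc t₀ t₁) t) (h01 : t₀ ≤ t₁)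
    (hL : 0 < L) (hT : 2 * L * (t₁ - t₀) ≤ 1)
    (hlip : ∀ w, ‖w - z t₀‖ ≤ r → ‖φ w - φ (z t₀)‖ ≤ L * ‖w - z t₀‖)
    (h0 : ‖φ (z t₀)‖ ≤ L * m) (hr : 2 * L * m * (t₁ - t₀) < r) :
    ‖z t₁ - z t₀ - (t₁ - t₀) • φ (z t₀)‖ ≤ 2 * L ^ 2 * m * (t₁ - t₀) ^ 2 := by
  have hm0 : 0 ≤ m := nonneg_of_mul_nonneg_right ((norm_nonneg _).trans h0) hL
  have hclose := norm_sub_initial_le_of_hasDerivWithinAt hz hL hT hlip h0 hr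
  -- The derivative of the Euler remainder is φ(z s) - φ(z t₀), already of order t₁ - t₀;
  -- integrating yields the second power.
  have h := norm_image_sub_le_of_norm_deriv_le_segment'
    (f := fun s => z s - (s - t₀) • φ (z t₀)) (f' := fun s => φ (z s) - φ (z t₀))
    (a := t₀) (b := t₁) (C := L * (2 * L * m * (t₁ - t₀))) ?_ ?_ t₁ ⟨h01, le_rfl⟩
  · have e : z t₁ - z t₀ - (t₁ - t₀) • φ (z t₀)
      = (z t₁ - (t₁ - t₀) • φ (z t₀)) - (z t₀ - (t₀ - t₀) • φ (z t₀)) := by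
      simp; abel
    rw [e]
    refine h.trans (le_of_eq ?_)
    ring
  · intro s hs
    refine (hz s hs).sub ?_
    simpa using (((hasDerivAt_id s).sub_const t₀).smul_const (φ (z t₀))).hasDerivWithinAt
  · intro s hs
    have hs' := Ico_subset_Icc_self hs
    have h1 := hclose s hs'
    have h2 : 2 * L * m * (s - t₀) ≤ 2 * L * m * (t₁ - t₀) := by
      have := hs'.2
      gcongr
    refine (hlip _ (by linarith)).trans ?_
    gcongr
    linarith

/-- Solutions of `ẋ = f(x) + u g(x)` exist on a time interval whose length is uniform over bounded
initial states and bounded inputs. -/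
theorem exists_uniform_solution_time [FiniteDimensional ℝ E]
    {f g : E → E} (hf : ContDiff ℝ 1 f) (hg : ContDiff ℝ 1 g) (R U : ℝ) :
    ∃ τ > 0, ∀ t₀ t₁ : ℝ, t₀ ≤ t₁ → t₁ - t₀ ≤ τ → ∀ (x₀ : E) (u : ℝ), ‖x₀‖ ≤ R → |u| ≤ U →
      ∃ s : ℝ → E, s t₀ = x₀ ∧
        ∀ t ∈ Icc t₀ t₁, HasDerivWithinAt s (f (s t) + u • g (s t)) (Icc t₀ t₁) t := by
  obtain ⟨Lf, hLf, hfl⟩ := exists_lipschitz_bound_closedBall hf (R + 1)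
  obtain ⟨Lg, hLg, hgl⟩ := exists_lipschitz_bound_closedBall hg (R + 1)
  obtain ⟨Mf, hMf, hfb⟩ := exists_norm_bound_closedBall hf.continuous (R + 1)
  obtain ⟨Mg, hMg, hgb⟩ := exists_norm_bound_closedBall hg.continuous (R + 1)
  set B := Mf + |U| * Mg with hB
  have hBpos : 0 < B := by positivity
  -- B bounds the speed on the unit ball around x₀, so the solution cannot leave that ball within
  -- time 1/B.
  refine ⟨1 / B, by positivity, fun t₀ t₁ h01 hτ x₀ u hx₀ hu => ?_⟩
  have huU : |u| ≤ |U| := hu.trans (le_abs_self U)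
  have hball : ∀ w ∈ Metric.closedBall x₀ ((1 : NNReal) : ℝ), ‖w‖ ≤ R + 1 := by
    intro w hw
    rw [Metric.mem_closedBall, dist_eq_norm] at hw
    have := norm_add_le x₀ (w - x₀)
    rw [add_sub_cancel] at this
    simp at hw
    linarith
  have hP : IsPicardLindelof (fun _ x => f x + u • g x) (tmin := t₀) (tmax := t₁)
      ⟨t₀, le_rfl, h01⟩ x₀ 1 0 B.toNNReal (Lf + |U| * Lg).toNNReal := by
    refine IsPicardLindelof.of_time_independent ?_ ?_ ?_
    · intro w hw
      rw [Real.coe_toNNReal _ hBpos.le]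
      refine (norm_add_le _ _).trans ?_
      rw [norm_smul, Real.norm_eq_abs]
      exact add_le_add (hfb w (hball w hw))
        (mul_le_mul huU (hgb w (hball w hw)) (norm_nonneg _) (abs_nonneg _))
    · refine LipschitzOnWith.of_dist_le_mul fun w hw w' hw' => ?_
      rw [Real.coe_toNNReal _ (by positivity), dist_eq_norm, dist_eq_norm]
      have e : f w + u • g w - (f w' + u • g w') = (f w - f w') + u • (g w - g w') := by
        rw [smul_sub]; abel
      rw [e, add_mul, mul_assoc]
      refine (norm_add_le _ _).trans ?_
      rw [norm_smul, Real.norm_eq_abs]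
      exact add_le_add (hfl _ _ (hball w hw) (hball w' hw'))
        (mul_le_mul huU (hgl _ _ (hball w hw) (hball w' hw')) (norm_nonneg _) (abs_nonneg _))
    · rw [Real.coe_toNNReal _ hBpos.le]
      have : max (t₁ - t₀) (t₀ - t₀) ≤ 1 / B := by
        rw [max_le_iff]; exact ⟨hτ, by simp; positivity⟩
      calc B * max (t₁ - t₀) (t₀ - t₀) ≤ B * (1 / B) := by gcongr
        _ = _ := by field_simp; simp
  have := FiniteDimensional.complete ℝ E
  obtain ⟨s, hs0, hs⟩ := hP.exists_eq_forall_mem_Icc_hasDerivWithinAt₀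
  exact ⟨s, hs0, hs⟩

end ODE

/-! ### Lyapunov decrease over one sampling interval -/

section Lyapunov

variable {E : Type*} [NormedAddCommGroup E] [InnerProductSpace ℝ E]

/-- Decrease of a quadratic Lyapunov function `⟪z, P z⟫` over one sampling interval of length `T`,
for a state that moves by `T (A z - e B)` up to `O(T²)`. -/
theorem exists_lyapunov_decrease_of_euler_step (A P : E →L[ℝ] E) (B : E) {q c : ℝ} (hq : 0 < q)
    (hsymm : ∀ x y, inner ℝ (P x) y = inner ℝ x (P y))
    (hA : ∀ x, 2 * inner ℝ (P x) (A x) ≤ -(q * ‖x‖ ^ 2)) (hc : 0 < c) :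
    ∃ a > 0, ∃ C > 0, ∃ T₁ > 0, ∀ T, 0 < T → T ≤ T₁ → ∀ (z z' : E) (e : ℝ),
      ‖z' - z‖ ≤ c * T * (‖z‖ + |e|) →
      ‖z' - z - T • (A z - e • B)‖ ≤ c * T ^ 2 * (‖z‖ + |e|) →
      inner ℝ z' (P z') ≤ (1 - a * T) * inner ℝ z (P z) + C * T * e ^ 2 := by
  set p := ‖P‖ with hp
  have hp0 : 0 ≤ p := norm_nonneg _
  set β := p * ‖B‖ with hβ
  have hβ0 : 0 ≤ β := by positivity
  set c₃ := 2 * (2 * p * c + p * c ^ 2) with hc₃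
  have hc₃0 : 0 ≤ c₃ := by positivity
  -- Of the decay q‖z‖², the cross term with e takes a quarter by Young's inequality and the O(T²)
  -- remainder another quarter. The remaining half dominates aV because V ≤ (p + 1)‖z‖².
  refine ⟨q / (2 * (p + 1)), by positivity, 4 * β ^ 2 / q + q / 4, by positivity,
    q / (4 * (c₃ + 1)), by positivity, ?_⟩
  intro T hT hT1 z z' e h1 h2
  obtain ⟨d, rfl⟩ : ∃ d, z' = z + d := ⟨z' - z, by abel⟩
  rw [add_sub_cancel_left] at h1 h2
  obtain ⟨r, hr⟩ : ∃ r, r = d - T • (A z - e • B) := ⟨_, rfl⟩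
  rw [← hr] at h2
  have hd : d = T • (A z - e • B) + r := by rw [hr]; abel
  set s := ‖z‖ + |e| with hs
  have hs0 : 0 ≤ s := by positivity
  have hs2 : s ^ 2 ≤ 2 * (‖z‖ ^ 2 + e ^ 2) := by
    rw [hs, ← sq_abs e]; nlinarith [sq_nonneg (‖z‖ - |e|)]
  have hPn : ∀ w, ‖P w‖ ≤ p * ‖w‖ := fun w => P.le_opNorm w
  have hexp : inner ℝ (z + d) (P (z + d)) =
      inner ℝ z (P z) + 2 * inner ℝ (P z) d + inner ℝ d (P d) := by
    rw [map_add, inner_add_left, inner_add_right, inner_add_right, ← hsymm z d,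
      real_inner_comm (P z) d]
    ring
  have hlin : inner ℝ (P z) d =
      T * inner ℝ (P z) (A z) - T * e * inner ℝ (P z) B + inner ℝ (P z) r := by
    rw [hd, inner_add_right, inner_smul_right, inner_sub_right, inner_smul_right]
    ring
  have hB : -(e * inner ℝ (P z) B) ≤ β * ‖z‖ * |e| := by
    refine (neg_le_abs _).trans ?_
    rw [abs_mul]
    have h := (abs_real_inner_le_norm (P z) B).trans
      (mul_le_mul_of_nonneg_right (hPn z) (norm_nonneg B))
    calc |e| * |inner ℝ (P z) B| ≤ |e| * (p * ‖z‖ * ‖B‖) := by gcongr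
      _ = _ := by rw [hβ]; ring
  have hR : inner ℝ (P z) r ≤ p * c * T ^ 2 * s ^ 2 := by
    have hzs : ‖z‖ ≤ s := by rw [hs]; linarith [abs_nonneg e]
    calc inner ℝ (P z) r ≤ ‖P z‖ * ‖r‖ := real_inner_le_norm _ _
      _ ≤ (p * s) * (c * T ^ 2 * s) := by
        gcongr
        exact (hPn z).trans (by gcongr)
      _ = _ := by ring
  have hD : inner ℝ d (P d) ≤ p * c ^ 2 * T ^ 2 * s ^ 2 := by
    calc inner ℝ d (P d) ≤ ‖d‖ * ‖P d‖ := real_inner_le_norm _ _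
      _ ≤ ‖d‖ * (p * ‖d‖) := by gcongr; exact hPn d
      _ = p * ‖d‖ ^ 2 := by ring
      _ ≤ p * (c * T * s) ^ 2 := by gcongr
      _ = _ := by ring
  have hV : inner ℝ z (P z) ≤ (p + 1) * ‖z‖ ^ 2 := by
    calc inner ℝ z (P z) ≤ ‖z‖ * ‖P z‖ := real_inner_le_norm _ _
      _ ≤ ‖z‖ * (p * ‖z‖) := by gcongr; exact hPn z
      _ ≤ _ := by nlinarith [sq_nonneg ‖z‖]
  have hyoung : 2 * (β * ‖z‖ * |e|) ≤ q / 4 * ‖z‖ ^ 2 + 4 * β ^ 2 / q * e ^ 2 := by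
    have h : q / 4 * ‖z‖ ^ 2 + 4 * β ^ 2 / q * e ^ 2 - 2 * (β * ‖z‖ * |e|) =
        q / 4 * (‖z‖ - 4 * β / q * |e|) ^ 2 := by
      rw [← sq_abs e]; field_simp; ring
    have : 0 ≤ q / 4 * (‖z‖ - 4 * β / q * |e|) ^ 2 := by positivity
    linarith
  have hcT : c₃ * T ≤ q / 4 := by
    calc c₃ * T ≤ (c₃ + 1) * (q / (4 * (c₃ + 1))) := by gcongr; linarith
      _ = q / 4 := by field_simp
  have hrem : 2 * (p * c * T ^ 2 * s ^ 2) + p * c ^ 2 * T ^ 2 * s ^ 2 ≤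
      T * (q / 4 * (‖z‖ ^ 2 + e ^ 2)) := by
    calc 2 * (p * c * T ^ 2 * s ^ 2) + p * c ^ 2 * T ^ 2 * s ^ 2
        = (2 * p * c + p * c ^ 2) * T ^ 2 * s ^ 2 := by ring
      _ ≤ (2 * p * c + p * c ^ 2) * T ^ 2 * (2 * (‖z‖ ^ 2 + e ^ 2)) := by gcongr
      _ = T * ((c₃ * T) * (‖z‖ ^ 2 + e ^ 2)) := by rw [hc₃]; ring
      _ ≤ _ := by gcongr
  have hVq : q / (2 * (p + 1)) * inner ℝ z (P z) ≤ q / 2 * ‖z‖ ^ 2 := by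
    calc q / (2 * (p + 1)) * inner ℝ z (P z) ≤ q / (2 * (p + 1)) * ((p + 1) * ‖z‖ ^ 2) := by
          gcongr
      _ = _ := by field_simp
  have t1 := mul_le_mul_of_nonneg_left (hA z) hT.le
  have t2 := mul_le_mul_of_nonneg_left hB hT.le
  have t3 := mul_le_mul_of_nonneg_left hyoung hT.le
  have t4 := mul_le_mul_of_nonneg_left hVq hT.le
  rw [hexp, hlin]
  nlinarith

/-- Estimates over one sampling interval for `ż = A z - G(z, u) B` with constant input `u`, where
`e = G(z, u)` can be solved for `u = H(z, e)`. -/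
theorem exists_sampled_step_estimates [FiniteDimensional ℝ E] (A P : E →L[ℝ] E) (B : E) {q : ℝ}
    (hq : 0 < q) (hsymm : ∀ x y, inner ℝ (P x) y = inner ℝ x (P y))
    (hA : ∀ x, 2 * inner ℝ (P x) (A x) ≤ -(q * ‖x‖ ^ 2))
    {G H : E × ℝ → ℝ} (hG : ContDiff ℝ 1 G) (hH : ContDiff ℝ 1 H)
    (hHG : ∀ z u, H (z, G (z, u)) = u) {u₀ : ℝ} (hG0 : G (0, u₀) = 0) (R U : ℝ) :
    ∃ a > 0, ∃ C > 0, ∃ T₁ > 0, ∀ t₀ t₁ : ℝ, t₀ < t₁ → t₁ - t₀ ≤ T₁ → ∀ (z : ℝ → E) (u : ℝ),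
      (∀ t ∈ Icc t₀ t₁, HasDerivWithinAt z (A (z t) - G (z t, u) • B) (Icc t₀ t₁) t) →
      ‖z t₀‖ ≤ R → |u| ≤ U →
      (∀ t ∈ Icc t₀ t₁, ‖z t - z t₀‖ ≤ C * (t₁ - t₀) * (‖z t₀‖ + |G (z t₀, u)|)) ∧
      inner ℝ (z t₁) (P (z t₁)) ≤ (1 - a * (t₁ - t₀)) * inner ℝ (z t₀) (P (z t₀)) +
        C * (t₁ - t₀) * G (z t₀, u) ^ 2 ∧
      |G (z t₁, u) - G (z t₀, u)| ≤ C * (t₁ - t₀) * (‖z t₀‖ + |G (z t₀, u)|) ∧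
      |u - u₀| ≤ C * (‖z t₀‖ + |G (z t₀, u)|) := by
  obtain ⟨E₀, hE₀, hGb⟩ := exists_norm_bound_closedBall hG.continuous (max |R| |U|)
  obtain ⟨L₁, hL₁, hGl⟩ := exists_lipschitz_bound_closedBall hG (max (|R| + 1) (max |U| |u₀|))
  obtain ⟨L₂, hL₂, hHl⟩ := exists_lipschitz_bound_closedBall hH (max |R| E₀)
  have hFd : ContDiff ℝ 1 (fun p : E × ℝ => A p.1 - G p • B) := by fun_prop
  obtain ⟨L, hL, hFl⟩ := exists_lipschitz_bound_closedBall hFd (max (|R| + 1) (max |U| |u₀|))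
  have hH0 : H (0, 0) = u₀ := by simpa [hG0] using hHG 0 u₀
  -- Lipschitz continuity of H gives |u - u₀| ≤ L₂s with s = ‖z‖ + |e|. The field vanishes at (0,
  -- u₀), so it is at most LDs; N is an a priori bound for Ds.
  set D := 1 + L₂ with hD
  have hD0 : 0 < D := by positivity
  set N := D * (|R| + E₀) with hN
  have hN0 : 0 ≤ N := by positivity
  set c := 2 * L * D + 2 * L ^ 2 * D with hc
  have hc0 : 0 < c := by positivity
  obtain ⟨a, ha, C, hC, T₁, hT₁, hdec⟩ :=
    exists_lyapunov_decrease_of_euler_step A P B hq hsymm hA hc0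
  -- The last bound on T keeps the solution within distance 1 of z t₀, where the Lipschitz constants
  -- are valid.
  refine ⟨a, ha, C + c + L₁ * c + L₂, by positivity,
    min T₁ (min (1 / (2 * L)) (1 / (2 * (2 * L * N + 1)))), by positivity, ?_⟩
  intro t₀ t₁ h01 hT z u hz hzR hu
  have hT' : 0 < t₁ - t₀ := sub_pos.2 h01
  rw [le_min_iff, le_min_iff] at hT
  obtain ⟨hTa, hTb, hTc⟩ := hT
  set T := t₁ - t₀ with hTdef
  set e := G (z t₀, u) with he
  set s := ‖z t₀‖ + |e| with hs
  have hs0 : 0 ≤ s := by positivity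
  have hzR' : ‖z t₀‖ ≤ |R| := hzR.trans (le_abs_self R)
  have huU : |u| ≤ |U| := hu.trans (le_abs_self U)
  have heE : |e| ≤ E₀ := by
    refine hGb _ ?_
    rw [Prod.norm_mk]
    exact max_le_max hzR' huU
  have huu : |u - u₀| ≤ L₂ * s := by
    have h := hHl (z t₀, e) (0, 0) (by rw [Prod.norm_mk]; exact max_le_max hzR' heE)
      (by simp)
    rw [hHG, hH0, Prod.mk_sub_mk, Prod.norm_mk, sub_zero, sub_zero, Real.norm_eq_abs] at h
    refine h.trans ?_
    gcongr
    exact max_le (by rw [hs]; linarith [abs_nonneg e])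
      (by rw [hs, Real.norm_eq_abs]; linarith [norm_nonneg (z t₀)])
  have hball : ∀ w, ‖w - z t₀‖ ≤ 1 → ‖((w, u) : E × ℝ)‖ ≤ max (|R| + 1) (max |U| |u₀|) := by
    intro w hw
    rw [Prod.norm_mk]
    refine max_le_max ?_ (huU.trans (le_max_left _ _))
    have := norm_add_le (z t₀) (w - z t₀)
    rw [add_sub_cancel] at this
    linarith
  have hpair : ∀ w w' : E, ‖((w, u) : E × ℝ) - (w', u)‖ = ‖w - w'‖ := by
    intro w w'
    rw [Prod.mk_sub_mk, Prod.norm_mk, sub_self, norm_zero, max_eq_left (norm_nonneg _)]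
  have hlip : ∀ w, ‖w - z t₀‖ ≤ 1 → ‖(A w - G (w, u) • B) - (A (z t₀) - G (z t₀, u) • B)‖ ≤
      L * ‖w - z t₀‖ := by
    intro w hw
    have h := hFl (w, u) (z t₀, u) (hball w hw) (hball _ (by simp))
    rwa [hpair] at h
  have hF0 : ‖A (z t₀) - G (z t₀, u) • B‖ ≤ L * (D * s) := by
    have h := hFl (z t₀, u) (0, u₀) (hball _ (by simp)) (by
      rw [Prod.norm_mk, norm_zero, Real.norm_eq_abs]
      exact max_le (by positivity) ((le_max_right _ _).trans (le_max_right _ _)))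
    simp only [map_zero, hG0, zero_smul, sub_zero, Prod.mk_sub_mk, Prod.norm_mk] at h
    refine h.trans ?_
    gcongr
    refine max_le ?_ ?_
    · rw [hD, hs]; nlinarith [abs_nonneg e, norm_nonneg (z t₀)]
    · rw [Real.norm_eq_abs, hD]; linarith
  have hsN : D * s ≤ N := by rw [hN, hs]; gcongr
  have h2LT : 2 * L * T ≤ 1 := by
    calc 2 * L * T ≤ 2 * L * (1 / (2 * L)) := by gcongr
      _ = 1 := by field_simp
  have hr : 2 * L * (D * s) * T < 1 := by
    calc 2 * L * (D * s) * T ≤ (2 * L * N + 1) * (1 / (2 * (2 * L * N + 1))) := by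
          gcongr
          nlinarith
      _ = 1 / 2 := by field_simp
      _ < 1 := by norm_num
  have hclose := norm_sub_initial_le_of_hasDerivWithinAt (φ := fun w => A w - G (w, u) • B)
    hz hL h2LT hlip hF0 hr
  have heuler := norm_sub_euler_step_le (φ := fun w => A w - G (w, u) • B)
    hz h01.le hL h2LT hlip hF0 hr
  have hclose' : ∀ t ∈ Icc t₀ t₁, ‖z t - z t₀‖ ≤ c * T * s := by
    intro t ht
    calc ‖z t - z t₀‖ ≤ 2 * L * (D * s) * (t - t₀) := hclose t ht
      _ ≤ 2 * L * (D * s) * T := by gcongr; linarith [ht.2]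
      _ = (2 * L * D) * T * s := by ring
      _ ≤ c * T * s := by
        gcongr
        rw [hc]
        have : 0 ≤ 2 * L ^ 2 * D := by positivity
        linarith
  have hend : t₁ ∈ Icc t₀ t₁ := ⟨h01.le, le_rfl⟩
  have hLc : 0 < L₁ * c := by positivity
  refine ⟨fun t ht => (hclose' t ht).trans ?_, ?_, ?_, huu.trans ?_⟩
  · gcongr; linarith
  · refine (hdec T hT' hTa (z t₀) (z t₁) e (hclose' t₁ hend) ?_).trans ?_
    · refine heuler.trans ?_
      calc 2 * L ^ 2 * (D * s) * T ^ 2 = (2 * L ^ 2 * D) * T ^ 2 * s := by ring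
        _ ≤ c * T ^ 2 * s := by
          gcongr
          rw [hc]
          have : 0 ≤ 2 * L * D := by positivity
          linarith
    · gcongr; linarith
  · have h1 : ‖z t₁ - z t₀‖ ≤ 1 := by
      refine (hclose t₁ hend).trans hr.le
    have h := hGl (z t₁, u) (z t₀, u) (hball _ h1) (hball _ (by simp))
    rw [hpair, Real.norm_eq_abs] at h
    calc _ ≤ L₁ * ‖z t₁ - z t₀‖ := h
      _ ≤ L₁ * (c * T * s) := by gcongr; exact hclose' t₁ hend
      _ = L₁ * c * T * s := by ring
      _ ≤ _ := by gcongr; linarith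
  · gcongr; linarith

end Lyapunov

/-! ### Squaring the contraction estimate -/

/-- Contraction of the squared input error over one sampling step. -/
theorem sq_le_of_abs_le_contraction {r d y e e' : ℝ} (hr : 0 ≤ r) (hrd : r + d ≤ (1 + r) / 2) (hr1 : r < 1)
    (h : |e'| ≤ r * |e| + d * (y + |e|)) :
    e' ^ 2 ≤ (1 + r) / 2 * e ^ 2 + 2 / (1 - r) * d ^ 2 * y ^ 2 := by
  have h1 : |e'| ≤ (1 + r) / 2 * |e| + d * y := by nlinarith [abs_nonneg e]
  have h2 : e' ^ 2 ≤ ((1 + r) / 2 * |e| + d * y) ^ 2 := by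
    rw [← sq_abs e']; gcongr
  have h3 : 0 < 1 - r := by linarith
  -- Convexity of the square with weights (1 + r)/2 and (1 - r)/2, written as an exact completed
  -- square.
  have h4 : (1 + r) / 2 * e ^ 2 + 2 / (1 - r) * d ^ 2 * y ^ 2 - ((1 + r) / 2 * |e| + d * y) ^ 2 =
      (1 + r) / 2 * ((1 - r) / 2) * (|e| - 2 / (1 - r) * (d * y)) ^ 2 := by
    rw [← sq_abs e]; field_simp; ring
  have h5 : 0 ≤ (1 + r) / 2 * ((1 - r) / 2) * (|e| - 2 / (1 - r) * (d * y)) ^ 2 := by positivity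
  linarith

/-! ### Linearizing coordinates and the Lyapunov equation -/

section Coordinates

variable {n : ℕ} {f g : EuclideanSpace ℝ (Fin n) → EuclideanSpace ℝ (Fin n)}
  {h : EuclideanSpace ℝ (Fin n) → ℝ}

theorem contDiff_lieDeriv (hf : ContDiff ℝ ∞ f) (hh : ContDiff ℝ ∞ h) :
    ContDiff ℝ ∞ (lieDeriv f h) :=
  (hh.fderiv_right (m := ∞) (by simp)).clm_apply hf

theorem contDiff_iterate_lieDeriv (hf : ContDiff ℝ ∞ f) (hh : ContDiff ℝ ∞ h) (i : ℕ) :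
    ContDiff ℝ ∞ ((lieDeriv f)^[i] h) := by
  induction i with
  | zero => simpa using hh
  | succ i ih => rw [Function.iterate_succ_apply']; exact contDiff_lieDeriv hf ih

/-- The closed-loop matrix `A₁ + B₁K` as an operator on Euclidean space. -/
noncomputable def closedLoopOperator {n : ℕ} (K : Fin n → ℝ) :
    EuclideanSpace ℝ (Fin n) →L[ℝ] EuclideanSpace ℝ (Fin n) :=
  Matrix.toEuclideanCLM (𝕜 := ℝ) (chainMatrix n + Matrix.vecMulVec (chainInput n) K)

theorem closedLoopOperator_apply (K : Fin n → ℝ) (z : EuclideanSpace ℝ (Fin n)) (i : Fin n) :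
    closedLoopOperator K z i =
      (chainMatrix n).mulVec z i + chainInput n i * virtualInput K z := by
  have : closedLoopOperator K z i =
    (chainMatrix n + Matrix.vecMulVec (chainInput n) K).mulVec z i := rfl
  rw [this, Matrix.add_mulVec, Pi.add_apply]
  congr 1
  simp [Matrix.mulVec, dotProduct, Matrix.vecMulVec_apply, virtualInput, Finset.mul_sum, mul_assoc]

/-- In the linearizing coordinates the system is `ż = (A₁ + B₁K) z - e_u B₁`. -/
theorem hasDerivWithinAt_linCoord (hf : ContDiff ℝ ∞ f) (hh : ContDiff ℝ ∞ h)
    (hrel : HasFullRelativeDegree f g h) (K : Fin n → ℝ)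
    {x : ℝ → EuclideanSpace ℝ (Fin n)} {u t : ℝ} {s : Set ℝ}
    (hx : HasDerivWithinAt x (f (x t) + u • g (x t)) s t) :
    HasDerivWithinAt (fun t => linCoord f h (x t))
      (closedLoopOperator K (linCoord f h (x t)) -
        inputError f g h K (x t) u • WithLp.toLp 2 (chainInput n)) s t := by
  rw [hasDerivWithinAt_iff_hasFDerivWithinAt, hasFDerivWithinAt_euclidean]
  intro i
  suffices H : HasDerivWithinAt (fun t => linCoord f h (x t) i)
      ((closedLoopOperator K (linCoord f h (x t)) -
        inputError f g h K (x t) u • WithLp.toLp 2 (chainInput n)) i) s t from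
    H.hasFDerivWithinAt.congr_fderiv (by ext; simp)
  have hd : HasFDerivAt ((lieDeriv f)^[(i : ℕ)] h)
      (fderiv ℝ ((lieDeriv f)^[(i : ℕ)] h) (x t)) (x t) :=
    ((contDiff_iterate_lieDeriv hf hh i).differentiable (by simp)).differentiableAt.hasFDerivAt
  have hcomp := hd.comp_hasDerivWithinAt t hx
  refine hcomp.congr_deriv ?_
  rw [map_add, map_smul, PiLp.sub_apply, closedLoopOperator_apply, PiLp.smul_apply]
  have h1 : fderiv ℝ ((lieDeriv f)^[(i : ℕ)] h) (x t) (f (x t)) =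
      (lieDeriv f)^[(i : ℕ) + 1] h (x t) := by
    rw [Function.iterate_succ_apply']; rfl
  have h2 : fderiv ℝ ((lieDeriv f)^[(i : ℕ)] h) (x t) (g (x t)) =
      lieDeriv g ((lieDeriv f)^[(i : ℕ)] h) (x t) := rfl
  rw [h1, h2]
  have hi := i.2
  -- In the last coordinate the shift gives 0 and Kz - e equals α + βu. In every other one the input
  -- term vanishes by the relative degree.
  by_cases hin : (i : ℕ) + 1 = n
  · have hchain : (chainMatrix n).mulVec (linCoord f h (x t)) i = 0 := by
      simp only [Matrix.mulVec, dotProduct, chainMatrix, Matrix.of_apply]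
      refine Finset.sum_eq_zero fun j _ => ?_
      have := j.2
      rw [if_neg (by omega), zero_mul]
    have hin' : (i : ℕ) = n - 1 := by omega
    rw [hchain]
    simp only [chainInput, if_pos hin, smul_eq_mul, inputError, topDeriv, driftTerm, controlGain]
    rw [hin, ← hin']
    ring
  · have hin1 : (i : ℕ) + 1 < n := by omega
    have hchain : (chainMatrix n).mulVec (linCoord f h (x t)) i =
        (lieDeriv f)^[(i : ℕ) + 1] h (x t) := by
      simp only [Matrix.mulVec, dotProduct, chainMatrix, Matrix.of_apply]
      rw [Finset.sum_eq_single (⟨(i : ℕ) + 1, hin1⟩ : Fin n)]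
      · simp [linCoord]
      · intro j _ hj
        rw [if_neg, zero_mul]
        intro hij
        exact hj (Fin.ext hij.symm)
      · simp
    rw [hchain, hrel.1 i hin1]
    simp [chainInput, hin]

/-- A positive definite quadratic form dominates a multiple of the squared norm. -/
theorem exists_pos_mul_norm_sq_le {M : Matrix (Fin n) (Fin n) ℝ} (hM : M.PosDef) :
    ∃ m > 0, ∀ z : EuclideanSpace ℝ (Fin n),
      m * ‖z‖ ^ 2 ≤ inner ℝ z (Matrix.toEuclideanCLM (𝕜 := ℝ) M z) := by
  have hpos : ∀ z : EuclideanSpace ℝ (Fin n), z ≠ 0 →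
      0 < inner ℝ z (Matrix.toEuclideanCLM (𝕜 := ℝ) M z) := by
    intro z hz
    rw [Matrix.inner_toEuclideanCLM]
    have := hM.dotProduct_mulVec_pos (x := z.ofLp) (by simpa using hz)
    simpa using this
  -- An empty sphere means that the space is trivial. Otherwise m is the minimum of the form on the
  -- compact unit sphere, and homogeneity of degree two does the rest.
  rcases (Metric.sphere (0 : EuclideanSpace ℝ (Fin n)) 1).eq_empty_or_nonempty with hs | hs
  · refine ⟨1, one_pos, fun z => ?_⟩
    by_cases hz : z = 0
    · simp [hz]
    · exfalso
      have : ‖z‖⁻¹ • z ∈ Metric.sphere (0 : EuclideanSpace ℝ (Fin n)) 1 := by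
        simp [norm_smul, inv_mul_cancel₀ (norm_ne_zero_iff.2 hz)]
      simp [hs] at this
  · obtain ⟨w, hw, hmin⟩ := (isCompact_sphere (0 : EuclideanSpace ℝ (Fin n)) 1).exists_isMinOn hs
      (f := fun z => inner ℝ z (Matrix.toEuclideanCLM (𝕜 := ℝ) M z)) (by fun_prop)
    have hw0 : w ≠ 0 := by
      rintro rfl
      simp at hw
    refine ⟨_, hpos w hw0, fun z => ?_⟩
    by_cases hz : z = 0
    · simp [hz]
    · have hn : ‖z‖ ≠ 0 := norm_ne_zero_iff.2 hz
      have hmem : ‖z‖⁻¹ • z ∈ Metric.sphere (0 : EuclideanSpace ℝ (Fin n)) 1 := by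
        simp [norm_smul, inv_mul_cancel₀ hn]
      have h1 := hmin hmem
      simp only [mem_ofPred_eq, map_smul, inner_smul_left, inner_smul_right] at h1
      have h2 : ‖z‖ ^ 2 * (‖z‖⁻¹ * (‖z‖⁻¹ *
          inner ℝ z (Matrix.toEuclideanCLM (𝕜 := ℝ) M z))) =
          inner ℝ z (Matrix.toEuclideanCLM (𝕜 := ℝ) M z) := by
        field_simp
      have h3 := mul_le_mul_of_nonneg_left h1 (sq_nonneg ‖z‖)
      simp only [conj_trivial] at h3
      rw [h2] at h3
      linarith

/-- The Lyapunov equation in operator form. -/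
theorem IsStabilizingGain.exists_lyapunov_operator {K : Fin n → ℝ} (hK : IsStabilizingGain K) :
    ∃ P : EuclideanSpace ℝ (Fin n) →L[ℝ] EuclideanSpace ℝ (Fin n), ∃ p > 0, ∃ q > 0,
      (∀ x y, inner ℝ (P x) y = inner ℝ x (P y)) ∧ (∀ x, p * ‖x‖ ^ 2 ≤ inner ℝ x (P x)) ∧
      ∀ x, 2 * inner ℝ (P x) (closedLoopOperator K x) ≤ -(q * ‖x‖ ^ 2) := by
  obtain ⟨P, Q, hP, hQ, heq⟩ := hK
  obtain ⟨p, hp, hPp⟩ := exists_pos_mul_norm_sq_le hP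
  obtain ⟨q, hq, hQq⟩ := exists_pos_mul_norm_sq_le hQ
  have hPT : P.transpose = P := Matrix.conjTranspose_eq_transpose_of_trivial P ▸ hP.isHermitian
  have hsymm : ∀ x y : EuclideanSpace ℝ (Fin n), inner ℝ (Matrix.toEuclideanCLM (𝕜 := ℝ) P x) y =
      inner ℝ x (Matrix.toEuclideanCLM (𝕜 := ℝ) P y) := by
    intro x y
    rw [real_inner_comm, Matrix.inner_toEuclideanCLM, Matrix.inner_toEuclideanCLM]
    rw [Matrix.dotProduct_mulVec, ← Matrix.mulVec_transpose, hPT, dotProduct_comm]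
  refine ⟨Matrix.toEuclideanCLM (𝕜 := ℝ) P, p, hp, q, hq, hsymm, hPp, fun x => ?_⟩
  have h1 := hQq x
  rw [Matrix.inner_toEuclideanCLM] at h1
  -- By symmetry of P the two terms of the Lyapunov equation give the same quadratic form.
  have h2 : (x.ofLp) ⬝ᵥ (-Q).mulVec x.ofLp = 2 * inner ℝ
      (Matrix.toEuclideanCLM (𝕜 := ℝ) P x) (closedLoopOperator K x) := by
    rw [← heq, Matrix.add_mulVec, dotProduct_add, hsymm, closedLoopOperator,
      ← mul_apply_eq_comp, ← map_mul, Matrix.inner_toEuclideanCLM, two_mul]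
    congr 1
    rw [Matrix.dotProduct_mulVec, ← Matrix.mulVec_transpose, Matrix.transpose_mul,
      Matrix.transpose_transpose, hPT, dotProduct_comm]
  rw [← h2, Matrix.neg_mulVec, dotProduct_neg]
  linarith

theorem norm_appendCoord_le (z : EuclideanSpace ℝ (Fin n)) (s : ℝ) :
    ‖appendCoord z s‖ ≤ ‖z‖ + |s| := by
  have h1 : ‖appendCoord z s‖ ^ 2 = ‖z‖ ^ 2 + |s| ^ 2 := by
    rw [EuclideanSpace.norm_sq_eq, EuclideanSpace.norm_sq_eq, Fin.sum_univ_castSucc]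
    simp [appendCoord]
  refine abs_le_of_sq_le_sq' ?_ (by positivity) |>.2
  rw [h1]
  nlinarith [norm_nonneg z, abs_nonneg s, mul_nonneg (norm_nonneg z) (abs_nonneg s)]

end Coordinates

/-! ### Extension of finite trajectories and existence for all time -/

section Trajectories

variable {n : ℕ} {f g : EuclideanSpace ℝ (Fin n) → EuclideanSpace ℝ (Fin n)}
  {h : EuclideanSpace ℝ (Fin n) → ℝ} {K : Fin n → ℝ} {γ : ℝ} {ρ : ℕ} {ustar : ℕ → ℝ}
  {est : Estimator n} {T : ℝ} {N : ℕ} {x x' : ℝ → EuclideanSpace ℝ (Fin n)} {u u' : ℕ → ℝ}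

theorem IsClosedLoopUpTo.mono (hx : IsClosedLoopUpTo f g h K γ ρ ustar est T N x u) {k : ℕ}
    (hk : k ≤ N) : IsClosedLoopUpTo f g h K γ ρ ustar est T k x u where
  dynamics j hj := hx.dynamics j (hj.trans_le hk)
  transient j hj hjk := hx.transient j hj (hjk.trans hk)
  update j hj := hx.update j (hj.trans_le hk)

/-- With a causal estimator, being a trajectory up to time `NT` depends only on the state on
`[0, NT]` and on the first inputs. -/
theorem IsClosedLoopUpTo.congr (hx : IsClosedLoopUpTo f g h K γ ρ ustar est T N x u)
    (hest : est.IsCausal) (hT : 0 < T) (hxx : ∀ t ≤ N * T, x' t = x t)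
    (huu : ∀ j ≤ N, u' j = u j) : IsClosedLoopUpTo f g h K γ ρ ustar est T N x' u' where
  dynamics k hk t ht := by
    have hkN : ((k : ℝ) + 1) * T ≤ N * T := by
      have : (k : ℝ) + 1 ≤ N := by exact_mod_cast hk
      gcongr
    rw [hxx t (ht.2.trans hkN), huu k hk.le]
    exact (hx.dynamics k hk t ht).congr_of_mem (fun s hs => hxx s (hs.2.trans hkN)) ht
  transient k hk hkN := by rw [huu k hkN, hx.transient k hk hkN]
  update k hk hρ := by
    have he : est T k (fun t => h (x' t)) u' = est T k (fun t => h (x t)) u := by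
      refine hest T k _ _ _ _ hT (fun t ht => ?_) fun j hj => huu j (hj.trans hk.le)
      have : (k : ℝ) * T ≤ N * T := by gcongr
      rw [hxx t (ht.2.trans this)]
    rw [he, huu (k + 1) hk, huu k hk.le, hx.update k hk hρ]

/-- A trajectory up to time `NT` extends by one sampling interval if the differential equation with
the last input can be solved there. -/
theorem IsClosedLoopUpTo.exists_extension (hx : IsClosedLoopUpTo f g h K γ ρ ustar est T N x u)
    (hest : est.IsCausal) (hT : 0 < T) {s : ℝ → EuclideanSpace ℝ (Fin n)}
    (hs0 : s (N * T) = x (N * T))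
    (hs : ∀ t ∈ Icc (N * T) ((N + 1) * T),
      HasDerivWithinAt s (f (s t) + u N • g (s t)) (Icc (N * T) ((N + 1) * T)) t) :
    ∃ (x' : ℝ → EuclideanSpace ℝ (Fin n)) (u' : ℕ → ℝ), (∀ t ≤ N * T, x' t = x t) ∧
      (∀ j ≤ N, u' j = u j) ∧ IsClosedLoopUpTo f g h K γ ρ ustar est T (N + 1) x' u' := by
  classical
  set x' : ℝ → EuclideanSpace ℝ (Fin n) := fun t => if t ≤ N * T then x t else s t with hx'
  -- The new input uses the estimate on the old data; causality ensures that the extended data give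
  -- the same estimate.
  set u' : ℕ → ℝ := fun j => if j ≤ N then u j else if N + 1 < ρ then ustar j else
    u N + γ * (virtualInput K (fun i : Fin n => est T N (fun t => h (x t)) u i.castSucc) -
        est T N (fun t => h (x t)) u (Fin.last n)) with hu'
  have hxx : ∀ t ≤ N * T, x' t = x t := fun t ht => if_pos ht
  have huu : ∀ j ≤ N, u' j = u j := fun j hj => if_pos hj
  have hold : IsClosedLoopUpTo f g h K γ ρ ustar est T N x' u' := hx.congr hest hT hxx huu
  have hxs : ∀ t ∈ Icc (N * T) ((N + 1) * T), x' t = s t := by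
    intro t ht
    rcases ht.1.eq_or_lt with he | hlt
    · rw [← he, hxx _ le_rfl, hs0]
    · exact if_neg (not_le.2 hlt)
  refine ⟨x', u', hxx, huu, ?_, ?_, ?_⟩
  · intro k hk t ht
    rcases Nat.lt_succ_iff_lt_or_eq.1 hk with hk | rfl
    · exact hold.dynamics k hk t ht
    · rw [hxs t ht, huu k le_rfl]
      exact (hs t ht).congr_of_mem hxs ht
  · intro k hk hkN
    rcases hkN.lt_or_eq with hk' | rfl
    · exact hold.transient k hk (Nat.lt_succ_iff.1 hk')
    · simp [hu', hk]
  · intro k hk hρ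
    rcases Nat.lt_succ_iff_lt_or_eq.1 hk with hk | rfl
    · exact hold.update k hk hρ
    · have he : est T k (fun t => h (x' t)) u' = est T k (fun t => h (x t)) u := by
        refine hest T k _ _ _ _ hT (fun t ht => ?_) fun j hj => huu j hj
        rw [hxx t ht.2]
      rw [he, huu k le_rfl]
      simp [hu', not_lt.2 hρ]

/-- If every trajectory from `x₀` extends by one sampling interval, then there is a trajectory
from `x₀` on `[0, ∞)`. -/
theorem exists_isClosedLoop_of_extension (hest : est.IsCausal) (hT : 0 < T)
    (x₀ : EuclideanSpace ℝ (Fin n))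
    (hext : ∀ N x u, x 0 = x₀ → IsClosedLoopUpTo f g h K γ ρ ustar est T N x u →
      ∃ s : ℝ → EuclideanSpace ℝ (Fin n), s (N * T) = x (N * T) ∧
        ∀ t ∈ Icc (N * T) ((N + 1) * T),
          HasDerivWithinAt s (f (s t) + u N • g (s t)) (Icc (N * T) ((N + 1) * T)) t) :
    ∃ (x : ℝ → EuclideanSpace ℝ (Fin n)) (u : ℕ → ℝ),
      x 0 = x₀ ∧ IsClosedLoop f g h K γ ρ ustar est T x u := by
  have hstep : ∀ N (p : (ℝ → EuclideanSpace ℝ (Fin n)) × (ℕ → ℝ)),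
      -- The hypotheses sit inside the existential so that the extension can be chosen for all pairs
      -- and iterated.
      ∃ p' : (ℝ → EuclideanSpace ℝ (Fin n)) × (ℕ → ℝ), p.1 0 = x₀ →
        IsClosedLoopUpTo f g h K γ ρ ustar est T N p.1 p.2 →
        (∀ t ≤ N * T, p'.1 t = p.1 t) ∧ (∀ j ≤ N, p'.2 j = p.2 j) ∧
          IsClosedLoopUpTo f g h K γ ρ ustar est T (N + 1) p'.1 p'.2 := by
    intro N p
    by_cases hp : p.1 0 = x₀ ∧ IsClosedLoopUpTo f g h K γ ρ ustar est T N p.1 p.2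
    · obtain ⟨s, hs0, hs⟩ := hext N p.1 p.2 hp.1 hp.2
      obtain ⟨x', u', h1, h2, h3⟩ := hp.2.exists_extension hest hT hs0 hs
      exact ⟨(x', u'), fun _ _ => ⟨h1, h2, h3⟩⟩
    · exact ⟨p, fun h1 h2 => absurd ⟨h1, h2⟩ hp⟩
  choose next hnext using hstep
  set traj : ℕ → (ℝ → EuclideanSpace ℝ (Fin n)) × (ℕ → ℝ) :=
    fun N => Nat.rec (fun _ => x₀, ustar) (fun N p => next N p) N with htraj
  have hsucc : ∀ N, traj (N + 1) = next N (traj N) := fun N => rfl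
  have hNT : ∀ N : ℕ, 0 ≤ (N : ℝ) * T := fun N => by positivity
  have hinv : ∀ N, (traj N).1 0 = x₀ ∧
      IsClosedLoopUpTo f g h K γ ρ ustar est T N (traj N).1 (traj N).2 := by
    intro N
    induction N with
    | zero => exact ⟨rfl, fun k hk => absurd hk (Nat.not_lt_zero k), fun _ _ _ => rfl,
        fun k hk => absurd hk (Nat.not_lt_zero k)⟩
    | succ N ih =>
      obtain ⟨h1, h2, h3⟩ := hnext N (traj N) ih.1 ih.2
      rw [hsucc]
      exact ⟨(h1 0 (hNT N)).trans ih.1, h3⟩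
  have hagree : ∀ N M : ℕ, N ≤ M → (∀ t ≤ N * T, (traj M).1 t = (traj N).1 t) ∧
      ∀ j ≤ N, (traj M).2 j = (traj N).2 j := by
    intro N M hNM
    induction M, hNM using Nat.le_induction with
    | base => exact ⟨fun _ _ => rfl, fun _ _ => rfl⟩
    | succ M hM ih =>
      obtain ⟨h1, h2, -⟩ := hnext M (traj M) (hinv M).1 (hinv M).2
      rw [hsucc]
      refine ⟨fun t ht => ?_, fun j hj => (h2 j (hj.trans hM)).trans (ih.2 j hj)⟩
      have : (N : ℝ) * T ≤ M * T := by gcongr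
      exact (h1 t (ht.trans this)).trans (ih.1 t ht)
  -- The partial trajectories agree where both are defined, so at time t any index N with t ≤ NT
  -- would serve.
  refine ⟨fun t => (traj ⌈t / T⌉₊).1 t, fun j => (traj j).2 j, (hinv _).1, fun N => ?_⟩
  refine (hinv N).2.congr hest hT (fun t ht => ?_) fun j hj => ((hagree j N hj).2 j le_rfl).symm
  have hle : ⌈t / T⌉₊ ≤ N := Nat.ceil_le.2 ((div_le_iff₀ hT).2 ht)
  refine ((hagree _ N hle).1 t ?_).symm
  exact (div_le_iff₀ hT).1 (Nat.le_ceil _)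

end Trajectories

/-! ### The coupled sampled recursion -/

/-- Invariance and geometric decrease for the coupled sampled recursion of a Lyapunov function `v`
and a squared input error `w`, where `w` is driven from step `m` on and merely bounded before. -/
theorem exists_sampled_invariant {a C C₂ q c e₀ : ℝ} (m : ℕ) (ha : 0 < a) (hC : 0 < C)
    (hC₂ : 0 < C₂) (hq0 : 0 < q) (hq1 : q < 1) (hc : 0 ≤ c) (he₀ : 1 ≤ e₀) :
    ∃ T₂ > 0, ∃ l > 0, ∃ κ > 0, ∀ T, 0 < T → T ≤ T₂ → κ * T < 1 ∧ ∀ (v w : ℕ → ℝ) (N : ℕ),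
      v 0 ≤ c → (∀ k, 0 ≤ v k) → (∀ k, 0 ≤ w k) →
      (∀ k ≤ N, k ≤ m → v k ≤ c + 1 → w k ≤ e₀) →
      (∀ k < N, (∀ j ≤ k, v j ≤ c + 1 ∧ w j ≤ e₀) →
        v (k + 1) ≤ (1 - a * T) * v k + C * T * w k) →
      (∀ k < N, m ≤ k → (∀ j ≤ k, v j ≤ c + 1 ∧ w j ≤ e₀) → v (k + 1) ≤ c + 2 →
        w (k + 1) ≤ q * w k + C₂ * T ^ 2 * v k) →
      (∀ k ≤ N, v k ≤ c + 1 ∧ w k ≤ e₀) ∧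
      ∀ k < N, m ≤ k → v (k + 1) + l * T * w (k + 1) ≤ (1 - κ * T) * (v k + l * T * w k) := by
  have hq : 0 < 1 - q := by linarith
  set l := 2 * C / (1 - q) with hl
  have hl0 : 0 < l := by positivity
  -- With this weight, half of the contraction of lTw absorbs the coupling CTw; the other half pays
  -- for the decay rate κ = a/2.
  have hlC : l * (1 - q) = 2 * C := by rw [hl]; field_simp
  have hsmall : ∀ x y : ℝ, 0 ≤ x → 0 < y → ∃ τ > 0, ∀ T, 0 < T → T ≤ τ → x * T ≤ y := by
    intro x y hx hy
    refine ⟨y / (x + 1), by positivity, fun T hT hTτ => ?_⟩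
    calc x * T ≤ (x + 1) * (y / (x + 1)) := by gcongr; linarith
      _ = y := by field_simp
  obtain ⟨τ₁, hτ₁, h₁⟩ := hsmall a (1 - q) ha.le hq
  obtain ⟨τ₂, hτ₂, h₂⟩ := hsmall ((m + 1) * (C * e₀)) (1 / 2) (by positivity) (by norm_num)
  obtain ⟨τ₃, hτ₃, h₃⟩ := hsmall (l * e₀) (1 / 2) (by positivity) (by norm_num)
  obtain ⟨τ₄, hτ₄, h₄⟩ := hsmall (C₂ * (c + 1)) (1 - q) (by positivity) hq
  obtain ⟨τ₅, hτ₅, h₅⟩ := hsmall (l * C₂) (a / 2) (by positivity) (by positivity)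
  refine ⟨min 1 (min τ₁ (min τ₂ (min τ₃ (min τ₄ τ₅)))), by positivity, l, hl0, a / 2,
    by positivity, ?_⟩
  intro T hT hTmin
  simp only [le_min_iff] at hTmin
  obtain ⟨hT1, hTa, hTb, hTc, hTd, hTe⟩ := hTmin
  replace h₁ := h₁ T hT hTa
  replace h₂ := h₂ T hT hTb
  replace h₃ := h₃ T hT hTc
  replace h₄ := h₄ T hT hTd
  replace h₅ := h₅ T hT hTe
  have hTT : T ^ 2 ≤ T := by nlinarith
  refine ⟨by linarith, ?_⟩
  intro v w N hv0 hv hw hinit hvstep hwstep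
  have hvinc : ∀ k < N, (∀ j ≤ k, v j ≤ c + 1 ∧ w j ≤ e₀) → v (k + 1) ≤ v k + C * e₀ * T := by
    intro k hk hj
    have h := hvstep k hk hj
    have h' : C * T * w k ≤ C * T * e₀ := by gcongr; exact (hj k le_rfl).2
    have h'' : 0 ≤ a * T * v k := mul_nonneg (by positivity) (hv k)
    linarith
  have hCe : C * e₀ * T ≤ 1 / 2 := by
    refine le_trans ?_ h₂
    have : 0 ≤ (m : ℝ) * (C * e₀) * T := by positivity
    linarith
  -- The recursion for w needs v (k + 1) ≤ c + 2 in advance; one step adds at most 1/2 to v k ≤ c +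
  -- 1, which avoids circularity.
  have hw1 : ∀ k < N, m ≤ k → (∀ j ≤ k, v j ≤ c + 1 ∧ w j ≤ e₀) →
      w (k + 1) ≤ q * w k + C₂ * T ^ 2 * v k := by
    intro k hk hmk hj
    exact hwstep k hk hmk hj (by linarith [hvinc k hk hj, (hj k le_rfl).1])
  have hW : ∀ k < N, m ≤ k → (∀ j ≤ k, v j ≤ c + 1 ∧ w j ≤ e₀) →
      v (k + 1) + l * T * w (k + 1) ≤ (1 - a / 2 * T) * (v k + l * T * w k) := by
    intro k hk hmk hj
    have s1 := hvstep k hk hj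
    have s2 := mul_le_mul_of_nonneg_left (hw1 k hk hmk hj) (by positivity : 0 ≤ l * T)
    have s3 : l * C₂ * T * T ^ 2 * v k ≤ a / 2 * T * v k := by
      have h6 : l * C₂ * T * T ^ 2 ≤ a / 2 * T :=
        mul_le_mul h₅ hTT (by positivity) (by positivity)
      exact mul_le_mul_of_nonneg_right h6 (hv k)
    have s4 : 0 ≤ l * T * w k * ((1 - q) / 2 - a / 2 * T) :=
      mul_nonneg (mul_nonneg (by positivity) (hw k)) (by linarith)
    have s5 : C * T * w k = l * T * w k * ((1 - q) / 2) := by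
      have : C = l * (1 - q) / 2 := by linarith
      rw [this]; ring
    nlinarith
  -- Up to step m, v grows linearly and stays below c + 1/2. As lTe₀ ≤ 1/2, the weighted sum starts
  -- at step m below c + 1 and then decreases.
  have main : ∀ k ≤ N, ∀ j ≤ k, (v j ≤ c + 1 ∧ w j ≤ e₀) ∧ (j ≤ m → v j ≤ c + j * (C * e₀ * T)) ∧
      (m ≤ j → v j + l * T * w j ≤ c + 1) := by
    intro k
    induction k with
    | zero =>
      intro _ j hj
      obtain rfl : j = 0 := by omega
      have hw0 := hinit 0 (Nat.zero_le _) (Nat.zero_le _) (by linarith)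
      refine ⟨⟨by linarith, hw0⟩, fun _ => by simpa using hv0, fun _ => ?_⟩
      have : l * T * w 0 ≤ l * T * e₀ := by gcongr
      linarith
    | succ k ih =>
      intro hk j hj
      have ih' := ih (Nat.le_of_succ_le hk)
      rcases hj.lt_or_eq with hj | rfl
      · exact ih' j (Nat.lt_succ_iff.1 hj)
      have hprev : ∀ j ≤ k, v j ≤ c + 1 ∧ w j ≤ e₀ := fun j hj => (ih' j hj).1
      have hinc := hvinc k hk hprev
      rcases Nat.lt_or_ge k m with hkm | hkm
      · have hvk : v (k + 1) ≤ c + ((k + 1 : ℕ) : ℝ) * (C * e₀ * T) := by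
          have := (ih' k le_rfl).2.1 hkm.le
          push_cast
          linarith
        have hkm' : ((k + 1 : ℕ) : ℝ) * (C * e₀ * T) ≤ 1 / 2 := by
          refine le_trans ?_ h₂
          have : ((k + 1 : ℕ) : ℝ) ≤ m + 1 := by exact_mod_cast (by omega : k + 1 ≤ m + 1)
          calc ((k + 1 : ℕ) : ℝ) * (C * e₀ * T) ≤ (m + 1) * (C * e₀ * T) := by gcongr
            _ = _ := by ring
        have hwk := hinit (k + 1) hk hkm (by linarith)
        refine ⟨⟨by linarith, hwk⟩, fun _ => hvk, fun _ => ?_⟩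
        have : l * T * w (k + 1) ≤ l * T * e₀ := by gcongr
        linarith
      · have hWk := hW k hk hkm hprev
        have hWprev := (ih' k le_rfl).2.2 hkm
        have hWnn : 0 ≤ v k + l * T * w k :=
          add_nonneg (hv k) (mul_nonneg (by positivity) (hw k))
        have hW1 : v (k + 1) + l * T * w (k + 1) ≤ c + 1 := by
          have : 0 ≤ a / 2 * T * (v k + l * T * w k) := mul_nonneg (by positivity) hWnn
          linarith
        have hlw : 0 ≤ l * T * w (k + 1) := mul_nonneg (by positivity) (hw _)
        refine ⟨⟨by linarith, ?_⟩, fun h => by omega, fun _ => hW1⟩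
        have hwk := hw1 k hk hkm hprev
        have t1 : q * w k ≤ q * e₀ := by gcongr; exact (hprev k le_rfl).2
        have t2 : C₂ * T ^ 2 * v k ≤ C₂ * T * (c + 1) := by
          exact mul_le_mul (by gcongr) (hprev k le_rfl).1 (hv k) (by positivity)
        -- Here e₀ ≥ 1 enters: qe₀ plus a perturbation of at most 1 - q does not exceed e₀.
        have t3 : 1 - q ≤ (1 - q) * e₀ := by nlinarith
        linarith
  exact ⟨fun k hk => (main k hk k le_rfl).1,
    fun k hk hmk => hW k hk hmk fun j hj => (main k hk.le j hj).1⟩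

/-- If a sequence decreases geometrically from some index on, it tends to zero. -/
theorem tendsto_zero_of_geometric_decrease {W : ℕ → ℝ} {θ : ℝ} (m : ℕ) (hθ0 : 0 ≤ θ) (hθ1 : θ < 1)
    (hW : ∀ k, 0 ≤ W k) (hstep : ∀ k, m ≤ k → W (k + 1) ≤ θ * W k) :
    Tendsto W atTop (𝓝 0) := by
  rw [← tendsto_add_atTop_iff_nat m]
  have hb : ∀ j, W (j + m) ≤ θ ^ j * W m := by
    intro j
    induction j with
    | zero => simp
    | succ j ih =>
      have := hstep (j + m) (by omega)
      rw [show j + 1 + m = j + m + 1 by omega, pow_succ']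
      calc _ ≤ θ * W (j + m) := this
        _ ≤ θ * (θ ^ j * W m) := by gcongr
        _ = _ := by ring
  refine squeeze_zero (fun j => hW _) hb ?_
  simpa using (tendsto_pow_atTop_nhds_zero_of_lt_one hθ0 hθ1).mul_const (W m)

/-- Converts a bound on the estimation error into one on the only combination of the estimate that
the controller uses. -/
theorem abs_virtualInput_sub_last_le {n : ℕ} (K : Fin n → ℝ)
    (ζ : EuclideanSpace ℝ (Fin (n + 1))) :
    |virtualInput K (fun i => ζ i.castSucc) - ζ (Fin.last n)| ≤ (∑ i, |K i| + 1) * ‖ζ‖ := by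
  have hcoord : ∀ i, |ζ i| ≤ ‖ζ‖ := fun i => by simpa using PiLp.norm_apply_le ζ i
  have h1 : |virtualInput K (fun i => ζ i.castSucc)| ≤ (∑ i, |K i|) * ‖ζ‖ := by
    rw [virtualInput, Finset.sum_mul]
    refine (Finset.abs_sum_le_sum_abs _ _).trans (Finset.sum_le_sum fun i _ => ?_)
    rw [abs_mul]
    gcongr
    exact hcoord _
  refine (abs_sub _ _).trans ?_
  linarith [hcoord (Fin.last n)]

/-! ### The input error as a function of z and u -/

/-- Smooth expressions, in the linearizing coordinates `z = Ψ(x)`, for the input error and for the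
input as a function of the state and the input error. -/
theorem exists_smooth_inputError {n : ℕ}
    {f g : EuclideanSpace ℝ (Fin n) → EuclideanSpace ℝ (Fin n)}
    {h : EuclideanSpace ℝ (Fin n) → ℝ}
    (hf : ContDiff ℝ ∞ f) (hg : ContDiff ℝ ∞ g) (hh : ContDiff ℝ ∞ h)
    (hsign : ∀ x, 0 < controlGain f g h x) (hzero : linCoord f h 0 = 0) (K : Fin n → ℝ)
    {Φ : EuclideanSpace ℝ (Fin n) → EuclideanSpace ℝ (Fin n)} (hΦ : ContDiff ℝ ∞ Φ)
    (hΦl : Function.LeftInverse Φ (linCoord f h)) :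
    ∃ G H : EuclideanSpace ℝ (Fin n) × ℝ → ℝ, ContDiff ℝ 1 G ∧ ContDiff ℝ 1 H ∧
      (∀ z u, H (z, G (z, u)) = u) ∧ G (0, equilibriumInput f g h) = 0 ∧
      (∀ x u, inputError f g h K x u = G (linCoord f h x, u)) ∧
      ∀ z u u', G (z, u') = G (z, u) - controlGain f g h (Φ z) * (u' - u) := by
  have hα : ContDiff ℝ 1 (fun p : EuclideanSpace ℝ (Fin n) × ℝ => driftTerm f h (Φ p.1)) :=
    ((contDiff_iterate_lieDeriv hf hh n).comp (hΦ.comp contDiff_fst)).of_le (by norm_cast)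
  have hβ : ContDiff ℝ 1 (fun p : EuclideanSpace ℝ (Fin n) × ℝ => controlGain f g h (Φ p.1)) :=
    (((contDiff_lieDeriv hg (contDiff_iterate_lieDeriv hf hh (n - 1))).comp
      (hΦ.comp contDiff_fst))).of_le (by norm_cast)
  have hK : ContDiff ℝ 1 (fun p : EuclideanSpace ℝ (Fin n) × ℝ =>
      virtualInput K (fun i => p.1 i)) := by
    unfold virtualInput
    fun_prop
  -- G is affine in u with slope -β, and H solves e = G(z, u) for u; the sign condition makes the
  -- quotient smooth.
  refine ⟨fun p => virtualInput K (fun i => p.1 i) -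
      (driftTerm f h (Φ p.1) + controlGain f g h (Φ p.1) * p.2),
    fun p => (virtualInput K (fun i => p.1 i) - driftTerm f h (Φ p.1) - p.2) /
      controlGain f g h (Φ p.1), ?_, ?_, ?_, ?_, ?_, ?_⟩
  · exact hK.sub (hα.add (hβ.mul contDiff_snd))
  · exact ((hK.sub hα).sub contDiff_snd).div hβ fun p => (hsign _).ne'
  · intro z u
    have := (hsign (Φ z)).ne'
    simp only
    field_simp
    ring
  · have h0 : Φ 0 = 0 := by simpa [hzero] using hΦl 0
    have := (hsign 0).ne'
    simp only [h0, equilibriumInput, virtualInput]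
    field_simp
    simp
  · intro x u
    simp only [inputError, topDeriv, hΦl x]
  · intro z u u'
    simp only
    ring

/-! ### The closed loop -/

set_option maxHeartbeats 2000000 in
theorem theorem1 {n : ℕ} (hn : 1 ≤ n)
    (f g : EuclideanSpace ℝ (Fin n) → EuclideanSpace ℝ (Fin n))
    (h : EuclideanSpace ℝ (Fin n) → ℝ)
    (hf : ContDiff ℝ ∞ f) (hg : ContDiff ℝ ∞ g) (hh : ContDiff ℝ ∞ h)
    (hrel : HasFullRelativeDegree f g h)
    (hsign : ∀ x, 0 < controlGain f g h x)
    (hdiffeo : IsSmoothDiffeo (linCoord f h))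
    (hzero : linCoord f h 0 = 0)
    (K : Fin n → ℝ) (hK : IsStabilizingGain K)
    (ρ : ℕ) (hρ : 1 ≤ ρ) (ustar : ℕ → ℝ)
    (S : Set (EuclideanSpace ℝ (Fin n))) (hS : IsCompact S) (hS0 : 0 ∈ interior S) :
    ∃ γs > 0, (∀ βbar : ℝ, (∀ x, controlGain f g h x ≤ βbar) → βbar⁻¹ ≤ γs) ∧
      ∀ γ : ℝ, 0 < γ → γ < γs →
        ∀ est : Estimator n, est.IsCausal →
          HasErrorOrderT f g h K γ ρ ustar est S →
          ∃ Ts > 0, ∃ b > 0, ∀ T : ℝ, 0 < T → T ≤ Ts → ∀ x₀ ∈ S,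
            (∃ (x : ℝ → EuclideanSpace ℝ (Fin n)) (u : ℕ → ℝ),
              x 0 = x₀ ∧ IsClosedLoop f g h K γ ρ ustar est T x u) ∧
            ∀ (x : ℝ → EuclideanSpace ℝ (Fin n)) (u : ℕ → ℝ),
              x 0 = x₀ → IsClosedLoop f g h K γ ρ ustar est T x u →
                (∀ k : ℕ, ρ ≤ k + 1 → ‖est T k (fun t => h (x t)) u‖ ≤ b) ∧
                (∀ k : ℕ, |inputError f g h K (x (k * T)) (u k)| ≤ b) ∧
                (∀ t : ℝ, 0 ≤ t → ‖x t‖ ≤ b) ∧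
                Tendsto x atTop (𝓝 0) := by
  obtain ⟨hΨ, Φ, hΦ, hΦl, hΦr⟩ := hdiffeo
  obtain ⟨P, p, hp, q, hq, hsymm, hPp, hPA⟩ := hK.exists_lyapunov_operator
  obtain ⟨G, H, hG, hH, hHG, hG0, hGe, hGu⟩ :=
    exists_smooth_inputError hf hg hh hsign hzero K hΦ hΦl
  set V : EuclideanSpace ℝ (Fin n) → ℝ := fun z => inner ℝ z (P z) with hV
  have hVcont : Continuous V := by fun_prop
  have hV0 : ∀ z, 0 ≤ V z := fun z => le_trans (by positivity) (hPp z)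
  have hΦ0 : Φ 0 = 0 := by simpa [hzero] using hΦl 0
  have hβcont : Continuous (fun z => controlGain f g h (Φ z)) :=
    (contDiff_lieDeriv hg (contDiff_iterate_lieDeriv hf hh (n - 1))).continuous.comp hΦ.continuous
  obtain ⟨c, hc0, hc⟩ : ∃ c ≥ 0, ∀ x ∈ S, V (linCoord f h x) ≤ c := by
    obtain ⟨c, hc⟩ := hS.bddAbove_image (f := fun x => V (linCoord f h x))
      (hVcont.comp hΨ.continuous).continuousOn
    refine ⟨max c 0, le_max_right _ _, fun x hx => le_max_of_le_left (hc ⟨x, hx, rfl⟩)⟩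
  -- This ball contains the sublevel set V ≤ c + 2: the initial level c, plus 1 for the invariant
  -- region, plus 1 for the next sample.
  set R := √((c + 2) / p) with hR
  have hR0 : 0 ≤ R := Real.sqrt_nonneg _
  have hVR : ∀ z, V z ≤ c + 2 → ‖z‖ ≤ R := by
    intro z hz
    refine Real.le_sqrt_of_sq_le ?_
    rw [le_div_iff₀ hp]
    linarith [hPp z]
  obtain ⟨w₁, -, hw₁⟩ := (isCompact_closedBall (0 : EuclideanSpace ℝ (Fin n)) R).exists_isMaxOn
    ⟨0, by simpa using hR0⟩ hβcont.continuousOn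
  obtain ⟨w₂, -, hw₂⟩ := (isCompact_closedBall (0 : EuclideanSpace ℝ (Fin n)) R).exists_isMinOn
    ⟨0, by simpa using hR0⟩ hβcont.continuousOn
  set βmax := controlGain f g h (Φ w₁) with hβmax
  set βmin := controlGain f g h (Φ w₂) with hβmin
  have hβle : ∀ z, ‖z‖ ≤ R → controlGain f g h (Φ z) ≤ βmax := fun z hz =>
    hw₁ (by simpa using hz)
  have hleβ : ∀ z, ‖z‖ ≤ R → βmin ≤ controlGain f g h (Φ z) := fun z hz =>
    hw₂ (by simpa using hz)
  have hβmax0 : 0 < βmax := hsign _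
  have hβmin0 : 0 < βmin := hsign _
  -- βmax is a value of the gain, so any global bound βbar is at least βmax; no global bound is
  -- required.
  refine ⟨βmax⁻¹, by positivity, fun βbar hb => inv_anti₀ hβmax0 (hb _), ?_⟩
  intro γ hγ0 hγ est hest herr
  have hγβ : γ * βmax < 1 := by
    have := mul_lt_mul_of_pos_right hγ hβmax0
    rwa [inv_mul_cancel₀ hβmax0.ne'] at this
  set r := 1 - γ * βmin with hr
  have hr1 : r < 1 := by
    have : 0 < γ * βmin := by positivity
    linarith
  have hr0 : 0 ≤ r := by
    have h1 : βmin ≤ βmax := (hleβ 0 (by simpa using hR0)).trans (hβle 0 (by simpa using hR0))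
    have : γ * βmin ≤ γ * βmax := by gcongr
    linarith
  have h1r : 0 < 1 - r := by linarith
  set us := ∑ j ∈ Finset.range ρ, |ustar j| with hus
  -- e₁ bounds the input error while prescribed inputs act. The added 1 in e₀ makes e² ≤ e₀ imply
  -- |e| ≤ e₀.
  obtain ⟨e₁, he₁, hGb⟩ := exists_norm_bound_closedBall hG.continuous (max R us)
  set e₀ := e₁ ^ 2 + 1 with he₀
  have he₀1 : 1 ≤ e₀ := by rw [he₀]; nlinarith
  have habs : ∀ e : ℝ, e ^ 2 ≤ e₀ → |e| ≤ e₀ := by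
    intro e he
    refine abs_le_of_sq_le_sq' ?_ (by linarith) |> abs_le.2
    nlinarith
  obtain ⟨U, hU0, hHb⟩ := exists_norm_bound_closedBall hH.continuous (max R e₀)
  set u₀ := equilibriumInput f g h with hu₀
  obtain ⟨a, ha, C, hC, T₁, hT₁, hstep⟩ := exists_sampled_step_estimates (closedLoopOperator K) P
    (WithLp.toLp 2 (chainInput n)) hq hsymm hPA hG hH hHG hG0 R U
  -- The compact set given to the estimator hypothesis depends only on R and U, both fixed before T.
  obtain ⟨M, hM, T₀, hT₀, herrT⟩ := herr (Metric.closedBall 0 (R + U)) (isCompact_closedBall _ _)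
  set k₀ := ∑ i, |K i| + 1 with hk₀
  have hk₀pos : 0 < k₀ := by positivity
  set C₃ := C + k₀ * M * (1 + C) with hC₃
  have hC₃0 : 0 < C₃ := by positivity
  -- The driven phase starts at ρ - 1: u (ρ - 1) is the last prescribed input, and the update from
  -- there is the first to use an estimate.
  obtain ⟨T₂, hT₂, l, hl, κ, hκ, hinv⟩ := exists_sampled_invariant (ρ - 1) ha hC
    (C₂ := 2 / (1 - r) * C₃ ^ 2 / p) (by positivity) (q := (1 + r) / 2) (by positivity)
    (by linarith) hc0 he₀1
  set R₂ := R + C * (R + e₀) with hR₂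
  obtain ⟨X, hX, hΦb⟩ := exists_norm_bound_closedBall hΦ.continuous R₂
  obtain ⟨τ, hτ, hsol⟩ := exists_uniform_solution_time (hf.of_le (m := 1) (by norm_cast))
    (hg.of_le (m := 1) (by norm_cast)) X U
  have hRR₂ : R ≤ R₂ := by
    have : 0 ≤ C * (R + e₀) := by positivity
    linarith
  set Ts := min 1 (min T₀ (min T₁ (min T₂ (min τ ((1 - r) / (2 * C₃)))))) with hTs
  have hTs0 : 0 < Ts := by positivity
  have hTsle : ∀ T ≤ Ts, T ≤ 1 ∧ T ≤ T₀ ∧ T ≤ T₁ ∧ T ≤ T₂ ∧ T ≤ τ ∧ T ≤ (1 - r) / (2 * C₃) := by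
    intro T hT
    simpa only [hTs, le_min_iff] using hT
  have hbd : ∀ y v, V (linCoord f h y) ≤ c + 1 → inputError f g h K y v ^ 2 ≤ e₀ →
      ‖linCoord f h y‖ ≤ R ∧ |inputError f g h K y v| ≤ e₀ ∧ |v| ≤ U := by
    intro y v h1 h2
    have h3 := hVR _ (by linarith : V (linCoord f h y) ≤ c + 2)
    have h4 := habs _ h2
    refine ⟨h3, h4, ?_⟩
    have h5 := hHb (linCoord f h y, inputError f g h K y v)
      (by rw [Prod.norm_mk]; exact max_le_max h3 h4)
    rwa [hGe, hHG] at h5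
  have hstepx : ∀ T, 0 < T → T ≤ Ts → ∀ N x u,
      IsClosedLoopUpTo f g h K γ ρ ustar est T N x u → ∀ k < N,
      V (linCoord f h (x (k * T))) ≤ c + 1 → inputError f g h K (x (k * T)) (u k) ^ 2 ≤ e₀ →
      (∀ t ∈ Icc (k * T) ((k + 1) * T), ‖linCoord f h (x t) - linCoord f h (x (k * T))‖ ≤
        C * T * (‖linCoord f h (x (k * T))‖ + |inputError f g h K (x (k * T)) (u k)|)) ∧
      V (linCoord f h (x ((k + 1 : ℕ) * T))) ≤ (1 - a * T) * V (linCoord f h (x (k * T))) +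
        C * T * inputError f g h K (x (k * T)) (u k) ^ 2 ∧
      |G (linCoord f h (x ((k + 1 : ℕ) * T)), u k) - inputError f g h K (x (k * T)) (u k)| ≤
        C * T * (‖linCoord f h (x (k * T))‖ + |inputError f g h K (x (k * T)) (u k)|) ∧
      |u k - u₀| ≤ C * (‖linCoord f h (x (k * T))‖ + |inputError f g h K (x (k * T)) (u k)|) := by
    intro T hT hTTs N x u hx k hk h1 h2
    obtain ⟨h3, -, h5⟩ := hbd _ _ h1 h2
    have hTT : ((k : ℝ) + 1) * T - k * T = T := by ring
    have hs := hstep (k * T) ((k + 1) * T) (by linarith) (by rw [hTT]; exact (hTsle T hTTs).2.2.1)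
      (fun t => linCoord f h (x t)) (u k) (fun t ht => by
        have := hasDerivWithinAt_linCoord hf hh hrel K (hx.dynamics k hk t ht)
        rwa [hGe] at this) h3 h5
    rw [hTT] at hs
    simp only [← hGe] at hs
    push_cast
    simpa only [hGe] using hs
  have herrx : ∀ T, 0 < T → T ≤ Ts → ∀ N x u,
      IsClosedLoopUpTo f g h K γ ρ ustar est T N x u → x 0 ∈ S → ∀ k ≤ N, ρ - 1 ≤ k →
      (∀ j ≤ k, V (linCoord f h (x (j * T))) ≤ c + 1 ∧
        inputError f g h K (x (j * T)) (u j) ^ 2 ≤ e₀) →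
      ‖appendCoord (linCoord f h (x (k * T))) (topDeriv f g h (x (k * T)) (u k)) -
        est T k (fun t => h (x t)) u‖ ≤ M * T * (‖linCoord f h (x (k * T))‖ + |u k - u₀|) := by
    intro T hT hTTs N x u hx hx0 k hk hρk hj
    refine (herrT T hT (hTsle T hTTs).2.1 x u k (hx.mono hk) hx0 (fun j hjk => ?_)
      (by omega)).trans ?_
    · obtain ⟨h3, -, h5⟩ := hbd _ _ (hj j hjk).1 (hj j hjk).2
      rw [mem_closedBall_zero_iff]
      exact (norm_appendCoord_le _ _).trans (add_le_add h3 h5)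
    · gcongr
      exact norm_appendCoord_le _ _
  have key : ∀ T, 0 < T → T ≤ Ts → ∀ N x u, IsClosedLoopUpTo f g h K γ ρ ustar est T N x u →
      x 0 ∈ S →
      (∀ k ≤ N, V (linCoord f h (x (k * T))) ≤ c + 1 ∧
        inputError f g h K (x (k * T)) (u k) ^ 2 ≤ e₀) ∧
      ∀ k < N, ρ - 1 ≤ k →
        V (linCoord f h (x ((k + 1 : ℕ) * T))) +
          l * T * inputError f g h K (x ((k + 1 : ℕ) * T)) (u (k + 1)) ^ 2 ≤
        (1 - κ * T) * (V (linCoord f h (x (k * T))) +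
          l * T * inputError f g h K (x (k * T)) (u k) ^ 2) := by
    intro T hT hTTs N x u hx hx0
    obtain ⟨hT1, -, -, hT2, -, hT4⟩ := hTsle T hTTs
    refine (hinv T hT hT2).2 (fun k => V (linCoord f h (x (k * T))))
      (fun k => inputError f g h K (x (k * T)) (u k) ^ 2) N (by simpa using hc _ hx0)
      (fun k => hV0 _) (fun k => sq_nonneg _) ?_ ?_ ?_
    · intro k hk hkρ hVk
      have hk' : k < ρ := by omega
      have h1 : |u k| ≤ us := by
        rw [hx.transient k hk' hk]
        exact Finset.single_le_sum (f := fun j => |ustar j|) (fun j _ => abs_nonneg _)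
          (Finset.mem_range.2 hk')
      have h2 := hGb (linCoord f h (x (k * T)), u k) (by
        rw [Prod.norm_mk]
        exact max_le_max (hVR _ (by linarith)) h1)
      rw [← hGe, Real.norm_eq_abs] at h2
      have h3 := pow_le_pow_left₀ (abs_nonneg _) h2 2
      rw [sq_abs] at h3
      linarith
    · intro k hk hj
      exact (hstepx T hT hTTs N x u hx k hk (hj k le_rfl).1 (hj k le_rfl).2).2.1
    · intro k hk hρk hj hV2
      obtain ⟨-, -, h1, h2⟩ := hstepx T hT hTTs N x u hx k hk (hj k le_rfl).1 (hj k le_rfl).2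
      have h3 := herrx T hT hTTs N x u hx hx0 k hk.le hρk hj
      have hz' := hVR _ hV2
      have hupd := hx.update k hk (by omega)
      set z := linCoord f h (x (k * T)) with hz
      set z' := linCoord f h (x ((k + 1 : ℕ) * T)) with hzz
      set e := inputError f g h K (x (k * T)) (u k) with he
      set ζ := est T k (fun t => h (x t)) u with hζ
      set b := controlGain f g h (Φ z') with hb
      -- η is the error made in estimating e; it is linear in the estimation error vector.
      set η := virtualInput K (fun i : Fin n => ζ i.castSucc) - ζ (Fin.last n) - e with hη
      have hηe : -η = virtualInput K (fun i : Fin n =>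
          (appendCoord z (topDeriv f g h (x (k * T)) (u k)) - ζ) i.castSucc) -
          (appendCoord z (topDeriv f g h (x (k * T)) (u k)) - ζ) (Fin.last n) := by
        simp only [hη, he, inputError, virtualInput, appendCoord, PiLp.sub_apply, Fin.snoc_castSucc,
          Fin.snoc_last, mul_sub, Finset.sum_sub_distrib]
        ring
      have hηb : |η| ≤ k₀ * M * (1 + C) * T * (‖z‖ + |e|) := by
        rw [← abs_neg, hηe]
        refine (abs_virtualInput_sub_last_le K _).trans ?_
        calc k₀ * _ ≤ k₀ * (M * T * (‖z‖ + |u k - u₀|)) := by gcongr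
          _ ≤ k₀ * (M * T * ((‖z‖ + |e|) + C * (‖z‖ + |e|))) := by
            gcongr
            linarith [abs_nonneg e]
          _ = _ := by ring
      have hbz := hβle _ hz'
      have hzb := hleβ _ hz'
      have hb0 : 0 < b := hsign _
      have hbγ : γ * b ≤ 1 := by
        have : γ * b ≤ γ * βmax := by gcongr
        linarith
      have hbr : 1 - γ * b ≤ r := by
        have : γ * βmin ≤ γ * b := by gcongr
        linarith
      -- The error at the next sample with the old input is e up to O(T); the update subtracts γ
      -- times the gain at z' times e + η.
      have he' : inputError f g h K (x ((k + 1 : ℕ) * T)) (u (k + 1)) =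
          (1 - γ * b) * e + (G (z', u k) - e) - γ * b * η := by
        rw [hGe, hGu _ (u k), hupd, hη]
        ring
      have hcontr : |inputError f g h K (x ((k + 1 : ℕ) * T)) (u (k + 1))| ≤
          r * |e| + C₃ * T * (‖z‖ + |e|) := by
        rw [he']
        have t1 : |(1 - γ * b) * e| ≤ r * |e| := by
          rw [abs_mul, abs_of_nonneg (by linarith)]
          gcongr
        have t2 : |γ * b * η| ≤ k₀ * M * (1 + C) * T * (‖z‖ + |e|) := by
          rw [abs_mul, abs_of_nonneg (by positivity)]
          exact (mul_le_of_le_one_left (abs_nonneg _) hbγ).trans hηb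
        refine (abs_sub _ _).trans ?_
        have t3 := abs_add_le ((1 - γ * b) * e) (G (z', u k) - e)
        rw [hC₃]
        linarith
      have hrd : r + C₃ * T ≤ (1 + r) / 2 := by
        have : C₃ * T ≤ (1 - r) / 2 := by
          calc C₃ * T ≤ C₃ * ((1 - r) / (2 * C₃)) := by gcongr
            _ = _ := by field_simp
        linarith
      refine (sq_le_of_abs_le_contraction hr0 hrd hr1 hcontr).trans ?_
      have : 2 / (1 - r) * (C₃ * T) ^ 2 * ‖z‖ ^ 2 ≤
          2 / (1 - r) * C₃ ^ 2 / p * T ^ 2 * V z := by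
        have hzV : ‖z‖ ^ 2 ≤ V z / p := by
          rw [le_div_iff₀ hp, mul_comm]
          exact hPp z
        calc 2 / (1 - r) * (C₃ * T) ^ 2 * ‖z‖ ^ 2 ≤ 2 / (1 - r) * (C₃ * T) ^ 2 * (V z / p) := by
              gcongr
          _ = _ := by ring
      exact add_le_add le_rfl this
  have hstate : ∀ y, ‖linCoord f h y‖ ≤ R₂ → ‖y‖ ≤ X := by
    intro y hy
    have := hΦb _ hy
    rwa [hΦl y] at this
  refine ⟨Ts, hTs0, R + (k₀ * R + e₀) + M * (R + (U + |u₀|)) + e₀ + X, by positivity, ?_⟩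
  intro T hT hTTs x₀ hx₀
  obtain ⟨hT1, hT0, -, hT2, hTτ, -⟩ := hTsle T hTTs
  refine ⟨exists_isClosedLoop_of_extension hest hT x₀ fun N x u hx0 hx => ?_, fun x u hx0 hx => ?_⟩
  -- The a priori bounds hold on any finite trajectory, so the uniform solution time τ always covers
  -- one more interval.
  · obtain ⟨h1, h2⟩ := (key T hT hTTs N x u hx (hx0 ▸ hx₀)).1 N le_rfl
    obtain ⟨h3, -, h5⟩ := hbd _ _ h1 h2
    exact hsol _ _ (by linarith) (by linarith) _ _ (hstate _ (h3.trans hRR₂)) h5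
  have hx0S : x 0 ∈ S := hx0 ▸ hx₀
  have hall : ∀ k : ℕ, V (linCoord f h (x (k * T))) ≤ c + 1 ∧
      inputError f g h K (x (k * T)) (u k) ^ 2 ≤ e₀ := fun k =>
    (key T hT hTTs k x u (hx k) hx0S).1 k le_rfl
  have hbk := fun k : ℕ => hbd _ _ (hall k).1 (hall k).2
  set s : ℕ → ℝ := fun k =>
    ‖linCoord f h (x (k * T))‖ + |inputError f g h K (x (k * T)) (u k)| with hs
  have hs0 : ∀ k, 0 ≤ s k := fun k => by positivity
  have hinter : ∀ t, 0 ≤ t → ‖linCoord f h (x t)‖ ≤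
      ‖linCoord f h (x (⌊t / T⌋₊ * T))‖ + C * s ⌊t / T⌋₊ := by
    intro t ht
    set k := ⌊t / T⌋₊ with hk
    have hkt : (k : ℝ) * T ≤ t := (le_div_iff₀ hT).1 (Nat.floor_le (by positivity))
    have htk : t ≤ ((k : ℝ) + 1) * T := ((div_lt_iff₀ hT).1 (Nat.lt_floor_add_one _)).le
    have h1 := (hstepx T hT hTTs (k + 1) x u (hx _) k (Nat.lt_succ_self k)
      (hall k).1 (hall k).2).1 t ⟨hkt, htk⟩
    have h2 : C * T * s k ≤ C * s k := by
      have := hs0 k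
      gcongr
      exact mul_le_of_le_one_right hC.le hT1
    have h3 := norm_add_le (linCoord f h (x (k * T))) (linCoord f h (x t) - linCoord f h (x (k * T)))
    rw [add_sub_cancel] at h3
    linarith
  refine ⟨fun k hk => ?_, fun k => ?_, fun t ht => ?_, ?_⟩
  · obtain ⟨h3, h4, h5⟩ := hbk k
    have h1 := herrx T hT hTTs k x u (hx k) hx0S k le_rfl (by omega) (fun j _ => hall j)
    have h2 := norm_appendCoord_le (linCoord f h (x (k * T))) (topDeriv f g h (x (k * T)) (u k))
    have hv : |virtualInput K (fun i => linCoord f h (x (k * T)) i)| ≤ k₀ * R := by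
      rw [virtualInput, hk₀]
      refine (Finset.abs_sum_le_sum_abs _ _).trans ?_
      have : ∑ i, |K i * linCoord f h (x (k * T)) i| ≤ (∑ i, |K i|) * R := by
        rw [Finset.sum_mul]
        refine Finset.sum_le_sum fun i _ => ?_
        rw [abs_mul]
        gcongr
        exact (PiLp.norm_apply_le (linCoord f h (x (k * T))) i).trans h3
      linarith
    have htop : |topDeriv f g h (x (k * T)) (u k)| ≤ k₀ * R + e₀ := by
      have : topDeriv f g h (x (k * T)) (u k) =
          virtualInput K (fun i => linCoord f h (x (k * T)) i) -
            inputError f g h K (x (k * T)) (u k) := by rw [inputError]; ring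
      rw [this]
      exact (abs_sub _ _).trans (add_le_add hv h4)
    have hMT : M * T * (‖linCoord f h (x (k * T))‖ + |u k - u₀|) ≤ M * (R + (U + |u₀|)) := by
      gcongr
      · exact mul_le_of_le_one_right hM.le hT1
      · exact (abs_sub _ _).trans (by gcongr)
    have h6 := norm_sub_norm_le (est T k (fun t => h (x t)) u)
      (appendCoord (linCoord f h (x (k * T))) (topDeriv f g h (x (k * T)) (u k)))
    rw [norm_sub_rev] at h6
    linarith
  · have h4 := (hbk k).2.1
    have : 0 ≤ R + (k₀ * R + e₀) + M * (R + (U + |u₀|)) + X := by positivity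
    linarith
  · obtain ⟨h3, h4, -⟩ := hbk ⌊t / T⌋₊
    have h5 : ‖x t‖ ≤ X := by
      refine hstate _ ((hinter t ht).trans ?_)
      rw [hR₂]
      gcongr
      exact add_le_add h3 h4
    have : 0 ≤ R + (k₀ * R + e₀) + M * (R + (U + |u₀|)) + e₀ := by positivity
    linarith
  · set W : ℕ → ℝ := fun k => V (linCoord f h (x (k * T))) +
      l * T * inputError f g h K (x (k * T)) (u k) ^ 2 with hW
    have hWlim : Tendsto W atTop (𝓝 0) := by
      refine tendsto_zero_of_geometric_decrease (θ := 1 - κ * T) (ρ - 1)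
        (by linarith [(hinv T hT hT2).1]) (by linarith [mul_pos hκ hT])
        (fun k => add_nonneg (hV0 _) (by positivity)) fun k hk => ?_
      exact (key T hT hTTs (k + 1) x u (hx _) hx0S).2 k (Nat.lt_succ_self k) hk
    -- T is fixed here, so the factor 1/(lT) is harmless and W → 0 forces both z and e to 0 at the
    -- samples.
    have hsW : ∀ k, s k ≤ √(2 * (1 / p + 1 / (l * T)) * W k) := by
      intro k
      refine Real.le_sqrt_of_sq_le ?_
      have hzV := hPp (linCoord f h (x (k * T)))
      have hlT : 0 < l * T := by positivity
      have hVW : V (linCoord f h (x (k * T))) ≤ W k := by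
        have : 0 ≤ l * T * inputError f g h K (x (k * T)) (u k) ^ 2 := by positivity
        simp only [hW]
        linarith
      have heW : l * T * inputError f g h K (x (k * T)) (u k) ^ 2 ≤ W k := by
        have := hV0 (linCoord f h (x (k * T)))
        simp only [hW]
        linarith
      have h1 : ‖linCoord f h (x (k * T))‖ ^ 2 ≤ 1 / p * W k := by
        rw [one_div_mul_eq_div, le_div_iff₀ hp]
        linarith
      have h2 : |inputError f g h K (x (k * T)) (u k)| ^ 2 ≤ 1 / (l * T) * W k := by
        rw [one_div_mul_eq_div, le_div_iff₀ hlT, sq_abs]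
        linarith
      have h3 : s k ^ 2 ≤ 2 * (‖linCoord f h (x (k * T))‖ ^ 2 +
          |inputError f g h K (x (k * T)) (u k)| ^ 2) := add_sq_le
      linarith
    have hslim : Tendsto s atTop (𝓝 0) := by
      refine squeeze_zero hs0 hsW ?_
      have := (hWlim.const_mul (2 * (1 / p + 1 / (l * T)))).sqrt
      simpa using this
    have hfloor : Tendsto (fun t : ℝ => ⌊t / T⌋₊) atTop atTop :=
      tendsto_nat_floor_atTop.comp (tendsto_id.atTop_div_const hT)
    have hzlim : Tendsto (fun t => linCoord f h (x t)) atTop (𝓝 0) := by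
      refine squeeze_zero_norm' (a := fun t => (1 + C) * s ⌊t / T⌋₊) ?_ ?_
      · filter_upwards [eventually_ge_atTop 0] with t ht
        have h1 := hinter t ht
        have h2 : ‖linCoord f h (x (⌊t / T⌋₊ * T))‖ ≤ s ⌊t / T⌋₊ :=
          le_add_of_nonneg_right (abs_nonneg _)
        linarith
      · simpa using (hslim.comp hfloor).const_mul (1 + C)
    have hxlim := (hΦ.continuous.tendsto 0).comp hzlim
    rw [hΦ0] at hxlim
    exact hxlim.congr fun t => hΦl (x t)
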